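/- Let $d\ge 1$ and let $f\in\mathbb{R}[x,y,z]$ be homogeneous of degree $d$ and hyperbolic with respect to $e\in\mathbb{R}^3$, that is, $f(e)\neq 0$ and for every $v\in\mathbb{R}^3$ the univariate polynomial $f(te+v)\in\mathbb{R}[t]$ has only real zeros. Assume that the complex projective plane curve $\mathcal{V}_{\mathbb{C}}(f)\subseteq\mathbb{P}^2$ is smooth, that is, $\nabla f(p)\neq 0$ for every $p\in\mathbb{C}^3\setminus\{0\}$ with $f(p)=0$. For univariate real polynomials $p,q$ with only real zeros and $\deg q=\deg p-1$, let $\alpha_1\le\dots\le\alpha_m$ be the zeros of $p$ and $\beta_1\le\dots\le\beta_{m-1}$ the zeros of $q$, listed with multiplicity; $q$ *interlaces* $p$ if $\alpha_i\le\beta_i\le\alpha_{i+1}$ for $i=1,\dots,m-1$. The cone of interlacers of $f$ is $$\mathrm{Int}(f,e)=\{g\in\mathbb{R}[x,y,z]_{d-1} : g(e)>0 \text{ and } g(te+v)\text{ interlaces } f(te+v)\text{ for every } v\in\mathbb{R}^3\},$$ and an *extremal interlacer* of $f$ is a form $g\in\mathrm{Int}(f,e)$ that spans an extreme ray of this cone.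 A *real contact point* of $g$ with $f$ is a point $p\in\mathbb{P}^2(\mathbb{R})$ with $f(p)=g(p)=0$ at which the intersection multiplicity $\mathrm{mult}_p(f,g)$ is even; in counting real contact points with multiplicity, $p$ is counted $\frac12\mathrm{mult}_p(f,g)$ times. Then every extremal interlacer $g$ of $f$ has only finitely many real contact points with $f$, and their number, counted with multiplicity, satisfies $$\sum_{p}\tfrac12\,\mathrm{mult}_p(f,g)\ \ge\ \left\lceil\frac{(d+1)d-2}{4}\right\rceil ,$$ where $p$ runs over the real contact points of $g$ with $f$. -/

import Mathlib

open MvPolynomial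

noncomputable section

/-- The restriction `f(t e + v)` of a ternary polynomial to a line, as a polynomial in `t`. -/
def restrictLine (f : MvPolynomial (Fin 3) ℝ) (e v : Fin 3 → ℝ) : Polynomial ℝ :=
  aeval (fun i => Polynomial.C (e i) * Polynomial.X + Polynomial.C (v i)) f

/-- `f` is hyperbolic with respect to `e`: `f(e) ≠ 0`, and `f(t e + v)` has only real zeros
for every real vector `v`. -/
def IsHyperbolic (f : MvPolynomial (Fin 3) ℝ) (e : Fin 3 → ℝ) : Prop :=
  eval e f ≠ 0 ∧ ∀ v : Fin 3 → ℝ, (restrictLine f e v).Splits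

/-- The complex projective plane curve defined by the real form `f` is smooth. -/
def IsSmoothCurve (f : MvPolynomial (Fin 3) ℝ) : Prop :=
  ∀ v : Fin 3 → ℂ, v ≠ 0 → aeval v f = 0 → ∃ i, aeval v (pderiv i f) ≠ 0

/-- The univariate polynomial `q` interlaces `p`: both are nonzero with only real zeros,
`deg q = deg p - 1`, and the ordered zeros `α` of `p` and `β` of `q` (listed with multiplicity)
satisfy `α i ≤ β i ≤ α (i + 1)` for all `i`. -/
def Interlaces (q p : Polynomial ℝ) : Prop :=
  p ≠ 0 ∧ q ≠ 0 ∧ ∃ (n : ℕ) (α : Fin (n + 1) → ℝ) (β : Fin n → ℝ),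
    Monotone α ∧ Monotone β ∧
    p = Polynomial.C p.leadingCoeff * ∏ i, (Polynomial.X - Polynomial.C (α i)) ∧
    q = Polynomial.C q.leadingCoeff * ∏ i, (Polynomial.X - Polynomial.C (β i)) ∧
    ∀ i : Fin n, α i.castSucc ≤ β i ∧ β i ≤ α i.succ

/-- The cone `Int(f, e)` of interlacers of a form `f` of degree `d`: forms `g` of degree `d - 1`
with `g(e) > 0` such that `g(t e + v)` interlaces `f(t e + v)` for every real vector `v`. -/
def interlacerCone (d : ℕ) (f : MvPolynomial (Fin 3) ℝ) (e : Fin 3 → ℝ) :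
    Set (MvPolynomial (Fin 3) ℝ) :=
  {g | g.IsHomogeneous (d - 1) ∧
    (∀ v : Fin 3 → ℝ, Interlaces (restrictLine g e v) (restrictLine f e v)) ∧ 0 < eval e g}

/-- `g` is an extremal interlacer of `f`: it lies in `Int(f, e)` and the open ray that it spans is
an extreme subset of `Int(f, e)` (the origin does not belong to `Int(f, e)`). -/
def IsExtremalInterlacer (d : ℕ) (f : MvPolynomial (Fin 3) ℝ) (e : Fin 3 → ℝ)
    (g : MvPolynomial (Fin 3) ℝ) : Prop :=
  g ∈ interlacerCone d f e ∧
    IsExtreme ℝ (interlacerCone d f e) {h | ∃ c : ℝ, 0 < c ∧ h = c • g}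

section Multiplicity

variable {K : Type*} [Field K]

/-- Dehomogenization: set the `i`-th variable equal to `1`. -/
def dehomogenize (i : Fin 3) (f : MvPolynomial (Fin 3) K) : MvPolynomial (Fin 2) K :=
  aeval (i.insertNth (1 : MvPolynomial (Fin 2) K) (X : Fin 2 → MvPolynomial (Fin 2) K) :
    Fin 3 → MvPolynomial (Fin 2) K) f

/-- The maximal ideal of polynomials vanishing at the point `a` of the affine plane. -/
def pointIdeal (a : Fin 2 → K) : Ideal (MvPolynomial (Fin 2) K) :=
  RingHom.ker (eval a : MvPolynomial (Fin 2) K →+* K)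

instance (a : Fin 2 → K) : (pointIdeal a).IsPrime :=
  RingHom.ker_isPrime (eval a : MvPolynomial (Fin 2) K →+* K)

/-- The intersection multiplicity of two affine plane curves at a `K`-rational point `a`:
`dim_K 𝒪_a / (f, g)`, with `𝒪_a` the local ring of the affine plane at `a`. -/
def affineIntersectionMultiplicity (f g : MvPolynomial (Fin 2) K) (a : Fin 2 → K) : ℕ :=
  Module.finrank K
    (Localization.AtPrime (pointIdeal a) ⧸
      (Ideal.span {f, g}).map
        (algebraMap (MvPolynomial (Fin 2) K) (Localization.AtPrime (pointIdeal a))))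

theorem exists_rep_apply_ne_zero (p : Projectivization K (Fin 3 → K)) : ∃ i, p.rep i ≠ 0 :=
  Function.ne_iff.mp p.rep_nonzero

/-- The index of some standard affine chart of the projective plane containing `p`. -/
def chartIndex (p : Projectivization K (Fin 3 → K)) : Fin 3 :=
  (exists_rep_apply_ne_zero p).choose

/-- The intersection multiplicity `mult_p(f, g)` of two plane projective curves at a `K`-rational
point `p`, computed in a standard affine chart containing `p`. (Since the dimension of the local
algebra is unchanged by extension of the base field, for real `f`, `g`, `p` this is also the
intersection multiplicity of the complex curves at `p`.) -/
def intersectionMultiplicity (f g : MvPolynomial (Fin 3) K)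
    (p : Projectivization K (Fin 3 → K)) : ℕ :=
  affineIntersectionMultiplicity (dehomogenize (chartIndex p) f) (dehomogenize (chartIndex p) g)
    (fun j => p.rep ((chartIndex p).succAbove j) / p.rep (chartIndex p))

end Multiplicity

/-- The real contact points of `g` with `f`: the real points of the projective plane on both
curves at which the intersection multiplicity is even. -/
def realContactPoints (f g : MvPolynomial (Fin 3) ℝ) : Set (Projectivization ℝ (Fin 3 → ℝ)) :=
  {p | eval p.rep f = 0 ∧ eval p.rep g = 0 ∧ Even (intersectionMultiplicity f g p)}

/-- The number of real contact points counted with multiplicity: a contact point with intersection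
multiplicity `2 m` is counted `m` times. -/
def realContactCount (f g : MvPolynomial (Fin 3) ℝ) : ℕ :=
  ∑ᶠ p ∈ realContactPoints f g, intersectionMultiplicity f g p / 2

end

/-!
The real points of the curve `f = 0` are regular and `D_e f` does not vanish at them, so a form
`g` of degree `d - 1` with `g(e) > 0` interlaces `f` exactly when `f(e) · D_e f · g ≥ 0` on the
curve. Hence an interlacer does not change sign along a real branch, all its intersection
multiplicities at real common zeros are even, and every real common zero is a contact point.

Let `h` be a form of degree `d - 1` whose germ lies in the ideal `(f, g)` of the local ring at
every contact point. Then `h = O(g)` on the curve near each of its real points, and by compactness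
`|h| ≤ C |g|` on the whole real curve, so that `g ± ε h` are again interlacers for small `ε > 0`.
If `g` is extremal, this forces `h ∈ ℝ g`. Since these `h` are cut out by `∑ mult_p(f, g)` linear
conditions on a space of dimension `d (d + 1) / 2`, we get `d (d + 1) / 2 - 1 ≤ ∑ mult_p(f, g)`.
-/

noncomputable section

/-! ### Polynomials along lines -/

section Lines

variable {σ R A : Type*}

theorem aeval_smul_of_isHomogeneous [CommSemiring R] [CommSemiring A] [Algebra R A]
    {f : MvPolynomial σ R} {d : ℕ} (hf : f.IsHomogeneous d) (c : A) (x : σ → A) :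
    aeval (c • x) f = c ^ d * aeval x f := by
  rw [aeval_def, aeval_def, eval₂_eq, eval₂_eq, Finset.mul_sum]
  refine Finset.sum_congr rfl fun m hm => ?_
  rw [hf.degree_eq_sum_deg_support hm, ← Finset.prod_pow_eq_pow_sum]
  simp only [Pi.smul_apply, smul_eq_mul, mul_pow, Finset.prod_mul_distrib]
  ring

theorem eval_smul_of_isHomogeneous [CommSemiring R] {f : MvPolynomial σ R} {d : ℕ}
    (hf : f.IsHomogeneous d) (c : R) (x : σ → R) : eval (c • x) f = c ^ d * eval x f := by
  simpa only [aeval_eq_eval] using aeval_smul_of_isHomogeneous hf c x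

/-- The generic point `t e + v` of a line, with coordinates in the polynomial ring `R[t]`. -/
def linePoint [CommSemiring R] (e v : σ → R) (i : σ) : Polynomial R :=
  Polynomial.C (e i) * Polynomial.X + Polynomial.C (v i)

/-- The derivative of a polynomial in the direction `e`, as a derivation. -/
def dirDeriv [CommSemiring R] (e : σ → R) :
    Derivation R (MvPolynomial σ R) (MvPolynomial σ R) :=
  mkDerivation R fun i => C (e i)

theorem dirDeriv_eq_sum [CommSemiring R] [Fintype σ] (e : σ → R) (f : MvPolynomial σ R) :
    dirDeriv e f = ∑ i, C (e i) * pderiv i f := by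
  classical
  induction f using MvPolynomial.induction_on with
  | C a => simp
  | add p q hp hq => simp only [map_add, hp, hq, mul_add, Finset.sum_add_distrib]
  | mul_X p i hp =>
    simp only [Derivation.leibniz, hp, smul_eq_mul, mul_add, Finset.sum_add_distrib]
    congr 1
    · simp [dirDeriv, pderiv_X, Pi.single_apply, mul_comm]
    · rw [Finset.mul_sum]
      exact Finset.sum_congr rfl fun _ _ => mul_left_comm _ _ _

theorem eval_dirDeriv [CommSemiring R] [Fintype σ] (e x : σ → R) (f : MvPolynomial σ R) :
    eval x (dirDeriv e f) = ∑ i, e i * eval x (pderiv i f) := by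
  simp [dirDeriv_eq_sum]

theorem eval_aeval_linePoint [CommSemiring R] (f : MvPolynomial σ R) (e v : σ → R) (t : R) :
    (aeval (linePoint e v) f).eval t = eval (t • e + v) f := by
  induction f using MvPolynomial.induction_on with
  | C a => simp [algHom_C]
  | add p q hp hq => simp [hp, hq]
  | mul_X p i hp => simp [linePoint, hp, mul_comm t]

theorem derivative_aeval_linePoint [CommSemiring R] (f : MvPolynomial σ R) (e v : σ → R) :
    Polynomial.derivative (aeval (linePoint e v) f) = aeval (linePoint e v) (dirDeriv e f) := by
  induction f using MvPolynomial.induction_on with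
  | C a => simp [algHom_C, derivation_C]
  | add p q hp hq => simp [hp, hq]
  | mul_X p i hp =>
    have hX : aeval (linePoint e v) (dirDeriv e (X i)) =
        Polynomial.derivative (linePoint e v i) := by
      simp [dirDeriv, linePoint, algHom_C]
    rw [map_mul, aeval_X, Polynomial.derivative_mul, hp, Derivation.leibniz, map_add, smul_eq_mul,
      smul_eq_mul, map_mul, map_mul, aeval_X, hX]
    ring

theorem hasDerivAt_eval_line {K : Type*} [NontriviallyNormedField K] (f : MvPolynomial σ K)
    (e v : σ → K) (t : K) :
    HasDerivAt (fun s : K => eval (s • e + v) f) (eval (t • e + v) (dirDeriv e f)) t := by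
  simpa only [eval_aeval_linePoint, derivative_aeval_linePoint] using
    (aeval (linePoint e v) f).hasDerivAt t

theorem natDegree_aeval_linePoint_le [CommSemiring R] {f : MvPolynomial σ R} {d : ℕ}
    (hf : f.totalDegree ≤ d) (e v : σ → R) : (aeval (linePoint e v) f).natDegree ≤ d := by
  simpa only [mul_one] using
    aeval_natDegree_le (n := 1) f hf (linePoint e v) fun _ => Polynomial.natDegree_linear_le

theorem coeff_aeval_linePoint_monomial [CommSemiring R] (m : σ →₀ ℕ) (c : R) (e v : σ → R) :
    (aeval (linePoint e v) (monomial m c)).coeff m.degree = eval e (monomial m c) := by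
  have hmonic : (aeval (linePoint e v) (monomial m (1 : R))).coeff m.degree =
      eval e (monomial m 1) := by
    have hdeg (m : σ →₀ ℕ) : (monomial m (1 : R)).totalDegree ≤ m.degree :=
      totalDegree_monomial_le m 1
    induction m using Finsupp.induction_linear with
    | zero => simp
    | add m₁ m₂ h₁ h₂ =>
      rw [← one_mul (1 : R), ← monomial_mul, map_mul, map_mul, ← h₁, ← h₂, map_add,
        Polynomial.coeff_mul_add_eq_of_natDegree_le
          (natDegree_aeval_linePoint_le (hdeg _) e v)
          (natDegree_aeval_linePoint_le (hdeg _) e v)]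
    | single i k =>
      have := Polynomial.coeff_pow_of_natDegree_le (m := k)
        (Polynomial.natDegree_linear_le (a := e i) (b := v i))
      rw [mul_one] at this
      simp [linePoint, aeval_monomial, eval_monomial, this, Polynomial.coeff_C]
  have hc : monomial m c = C c * monomial m (1 : R) := by rw [C_mul_monomial, mul_one]
  rw [hc, map_mul, algHom_C, ← Polynomial.C_eq_algebraMap, Polynomial.coeff_C_mul, hmonic, map_mul,
    eval_C]

theorem coeff_aeval_linePoint [CommSemiring R] {f : MvPolynomial σ R} {d : ℕ}
    (hf : f.IsHomogeneous d) (e v : σ → R) : (aeval (linePoint e v) f).coeff d = eval e f := by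
  conv_lhs => rw [f.as_sum]
  conv_rhs => rw [f.as_sum]
  rw [map_sum, map_sum, Polynomial.finsetSum_coeff]
  refine Finset.sum_congr rfl fun m hm => ?_
  have hd : d = m.degree := hf.degree_eq_sum_deg_support hm
  rw [hd, coeff_aeval_linePoint_monomial]

end Lines

section RestrictLine

variable {f : MvPolynomial (Fin 3) ℝ} {d : ℕ} {e : Fin 3 → ℝ}

theorem eval_restrictLine (f : MvPolynomial (Fin 3) ℝ) (e v : Fin 3 → ℝ) (t : ℝ) :
    (restrictLine f e v).eval t = eval (t • e + v) f :=
  eval_aeval_linePoint f e v t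

theorem derivative_restrictLine (f : MvPolynomial (Fin 3) ℝ) (e v : Fin 3 → ℝ) :
    Polynomial.derivative (restrictLine f e v) = restrictLine (dirDeriv e f) e v :=
  derivative_aeval_linePoint f e v

theorem natDegree_restrictLine (hf : f.IsHomogeneous d) (he : eval e f ≠ 0) (v : Fin 3 → ℝ) :
    (restrictLine f e v).natDegree = d :=
  Polynomial.natDegree_eq_of_le_of_coeff_ne_zero
    (natDegree_aeval_linePoint_le hf.totalDegree_le e v)
    ((coeff_aeval_linePoint hf e v).trans_ne he)

theorem leadingCoeff_restrictLine (hf : f.IsHomogeneous d) (he : eval e f ≠ 0)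
    (v : Fin 3 → ℝ) : (restrictLine f e v).leadingCoeff = eval e f := by
  rw [Polynomial.leadingCoeff, natDegree_restrictLine hf he]
  exact coeff_aeval_linePoint hf e v

end RestrictLine

/-! ### Transversality of hyperbolic curves -/

theorem derivative_div_sq_sub_prod_X_sub_C {K : Type*} [Field K] (s : Multiset K) {x : K}
    (hx : ∀ a ∈ s, x ≠ a) :
    let Q := (s.map fun a => Polynomial.X - Polynomial.C a).prod
    (Q.derivative.eval x / Q.eval x) ^ 2 - Q.derivative.derivative.eval x / Q.eval x =
      (s.map fun a => ((x - a) ^ 2)⁻¹).sum := by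
  induction s using Multiset.induction_on with
  | empty => simp
  | cons a s ih =>
    have ha : x - a ≠ 0 := sub_ne_zero.2 (hx a (Multiset.mem_cons_self a s))
    have hs : ∀ b ∈ s, x ≠ b := fun b hb => hx b (Multiset.mem_cons_of_mem hb)
    have hQ : ((s.map fun b => Polynomial.X - Polynomial.C b).prod).eval x ≠ 0 := by
      rw [Polynomial.eval_multiset_prod, Multiset.map_map]
      refine Multiset.prod_ne_zero fun h => ?_
      obtain ⟨b, hb, hb0⟩ := Multiset.mem_map.1 h
      exact hs b hb (sub_eq_zero.1 (by simpa using hb0))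
    simp only [Multiset.map_cons, Multiset.prod_cons, Multiset.sum_cons, ← ih hs]
    simp only [Polynomial.derivative_mul, Polynomial.derivative_sub, Polynomial.derivative_X,
      Polynomial.derivative_C, Polynomial.eval_mul, Polynomial.eval_add, Polynomial.eval_sub,
      Polynomial.eval_X, Polynomial.eval_C, Polynomial.derivative_add, sub_zero, one_mul]
    field_simp
    ring

theorem derivative_div_sq_sub_of_splits {K : Type*} [Field K] {P : Polynomial K}
    (hP : P.Splits) {x : K} (hx : P.eval x ≠ 0) :
    (P.derivative.eval x / P.eval x) ^ 2 - P.derivative.derivative.eval x / P.eval x =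
      (P.roots.map fun a => ((x - a) ^ 2)⁻¹).sum := by
  have hroots : ∀ a ∈ P.roots, x ≠ a := by
    rintro a ha rfl
    exact hx (Polynomial.isRoot_of_mem_roots ha)
  have hlead : P.leadingCoeff ≠ 0 := by
    rw [Polynomial.leadingCoeff_ne_zero]
    rintro rfl
    exact hx Polynomial.eval_zero
  rw [← derivative_div_sq_sub_prod_X_sub_C P.roots hroots]
  set Q := (P.roots.map fun a => Polynomial.X - Polynomial.C a).prod
  have hPQ : P = Polynomial.C P.leadingCoeff * Q := hP.eq_prod_roots
  generalize P.leadingCoeff = c at hlead hPQ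
  simp only [hPQ, Polynomial.derivative_C_mul, Polynomial.eval_C_mul,
    mul_div_mul_left _ _ hlead]

theorem sq_leadingCoeff_le_of_splits {K : Type*} [Field K] [LinearOrder K] [IsStrictOrderedRing K]
    {P : Polynomial K} (hP : P.Splits) {x S : K} (hx : P.eval x ≠ 0)
    (hS : (P.derivative.eval x / P.eval x) ^ 2 -
      P.derivative.derivative.eval x / P.eval x ≤ S) :
    P.leadingCoeff ^ 2 ≤ S ^ P.natDegree * P.eval x ^ 2 := by
  have hroot : ∀ a ∈ P.roots, 1 ≤ S * (x - a) ^ 2 := by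
    intro a ha
    have hxa : x ≠ a := by
      rintro rfl
      exact hx (Polynomial.isRoot_of_mem_roots ha)
    have hpos : 0 < (x - a) ^ 2 := sq_pos_of_ne_zero (sub_ne_zero.2 hxa)
    have hle : ((x - a) ^ 2)⁻¹ ≤ (P.roots.map fun b => ((x - b) ^ 2)⁻¹).sum := by
      refine Multiset.single_le_sum ?_ _ (Multiset.mem_map_of_mem _ ha)
      intro y hy
      obtain ⟨b, -, rfl⟩ := Multiset.mem_map.1 hy
      positivity
    rw [← derivative_div_sq_sub_of_splits hP hx] at hle
    exact (inv_le_iff_one_le_mul₀ hpos).1 (hle.trans hS)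
  have hprod : 1 ≤ (P.roots.map fun a => S * (x - a) ^ 2).prod := by
    refine Multiset.prod_induction (1 ≤ ·) _ (fun _ _ => one_le_mul_of_one_le_of_one_le) le_rfl ?_
    simpa only [Multiset.mem_map, forall_exists_index, and_imp, forall_apply_eq_imp_iff₂]
      using hroot
  have heval : P.eval x = P.leadingCoeff * (P.roots.map fun a => x - a).prod :=
    hP.eval_eq_prod_roots x
  rw [Multiset.prod_map_mul, Multiset.map_const', Multiset.prod_replicate, Multiset.prod_map_pow,
    ← hP.natDegree_eq_card_roots] at hprod
  calc P.leadingCoeff ^ 2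
      ≤ P.leadingCoeff ^ 2 * (S ^ P.natDegree * (P.roots.map fun a => x - a).prod ^ 2) :=
        le_mul_of_one_le_right (sq_nonneg _) hprod
    _ = S ^ P.natDegree * P.eval x ^ 2 := by rw [heval]; ring

open Filter Topology in
theorem exists_eventually_div_sq_sub_div_le {F G H : ℝ → ℝ} {F' G' H' : ℝ}
    (hF : HasDerivAt F F' 0) (hG : HasDerivAt G G' 0) (hH : HasDerivAt H H' 0) (hF0 : F 0 = 0)
    (hG0 : G 0 = 0) (hF' : F' ≠ 0) (hsign : 0 ≤ H 0 * F') :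
    ∃ S, ∀ᶠ s in 𝓝[>] 0, F s ≠ 0 ∧ (G s / F s) ^ 2 - H s / F s ≤ S := by
  have hF := hF.tendsto_slope_zero_right
  have hG := hG.tendsto_slope_zero_right
  have hH := hH.tendsto_slope_zero_right
  simp only [zero_add, hF0, hG0, sub_zero, smul_eq_mul] at hF hG hH
  have hlim : ∀ᶠ s in 𝓝[>] (0 : ℝ), (s⁻¹ * G s / (s⁻¹ * F s)) ^ 2 -
      s⁻¹ * (H s - H 0) / (s⁻¹ * F s) ≤ (G' / F') ^ 2 - H' / F' + 1 :=
    (((hG.div hF hF').pow 2).sub (hH.div hF hF')).eventually (eventually_le_nhds (lt_add_one _))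
  have hpos : ∀ᶠ s in 𝓝[>] (0 : ℝ), 0 < s⁻¹ * F s * F' :=
    (hF.mul_const F').eventually (lt_mem_nhds (mul_self_pos.2 hF'))
  refine ⟨(G' / F') ^ 2 - H' / F' + 1, ?_⟩
  filter_upwards [hlim, hpos, self_mem_nhdsWithin] with s hs hFs (hs0 : 0 < s)
  have hFs0 : F s ≠ 0 := by
    rintro h
    simp [h] at hFs
  refine ⟨hFs0, le_trans ?_ hs⟩
  have hH0 : 0 ≤ H 0 / F s := by
    have : H 0 / F s = H 0 * F' * (s⁻¹ * F s * F') * s / (F s * F') ^ 2 := by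
      field_simp
    rw [this]
    positivity
  rw [mul_div_mul_left _ _ (inv_ne_zero hs0.ne'), mul_div_mul_left _ _ (inv_ne_zero hs0.ne'),
    sub_div]
  linarith

open Filter Topology in
theorem IsHyperbolic.eval_dirDeriv_ne_zero {f : MvPolynomial (Fin 3) ℝ} {d : ℕ}
    (hf : f.IsHomogeneous d) {e : Fin 3 → ℝ} (hyp : IsHyperbolic f e) {p w : Fin 3 → ℝ}
    (hp : eval p f = 0) (hw : eval p (dirDeriv w f) ≠ 0) : eval p (dirDeriv e f) ≠ 0 := by
  intro hpe
  wlog hsign : 0 ≤ eval p (dirDeriv e (dirDeriv e f)) * eval p (dirDeriv w f) generalizing w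
  · have hneg : eval p (dirDeriv (-w) f) = -eval p (dirDeriv w f) := by simp [eval_dirDeriv]
    refine this (w := -w) (by rwa [hneg, neg_ne_zero]) ?_
    rw [hneg, mul_neg]
    linarith
  have hderiv (q : MvPolynomial (Fin 3) ℝ) :
      HasDerivAt (fun s : ℝ => eval (s • w + p) q) (eval p (dirDeriv w q)) 0 := by
    simpa using hasDerivAt_eval_line q w p 0
  -- If `a` runs over the zeros of `t ↦ f(t e + s w + p)`, then `∑ 1 / a ^ 2` stays bounded as
  -- `s → 0`, so no zero tends to `0`; but `f(p) = 0`.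
  obtain ⟨S, hS⟩ := exists_eventually_div_sq_sub_div_le (hderiv f) (hderiv (dirDeriv e f))
    (hderiv (dirDeriv e (dirDeriv e f))) (by simpa using hp) (by simpa using hpe) hw
    (by simpa using hsign)
  have hbound : ∀ᶠ s in 𝓝[>] (0 : ℝ), eval e f ^ 2 ≤ S ^ d * eval (s • w + p) f ^ 2 := by
    filter_upwards [hS] with s ⟨hs, hsS⟩
    have := sq_leadingCoeff_le_of_splits (hyp.2 (s • w + p)) (x := 0) (S := S)
    simp only [derivative_restrictLine, eval_restrictLine, zero_smul, zero_add,
      leadingCoeff_restrictLine hf hyp.1, natDegree_restrictLine hf hyp.1] at this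
    exact this hs hsS
  have hlim : Tendsto (fun s : ℝ => S ^ d * eval (s • w + p) f ^ 2) (𝓝[>] 0) (𝓝 0) := by
    have := (((hderiv f).continuousAt.tendsto.pow 2).const_mul (S ^ d)).mono_left
      (nhdsWithin_le_nhds (s := Set.Ioi 0))
    simpa [hp] using this
  exact hyp.1 (pow_eq_zero_iff two_ne_zero |>.1
    ((ge_of_tendsto hlim hbound).antisymm (sq_nonneg _)))

/-- The real points of the projective plane curve of `f` are nonsingular. -/
def IsRealRegular (f : MvPolynomial (Fin 3) ℝ) : Prop :=
  ∀ p : Fin 3 → ℝ, p ≠ 0 → eval p f = 0 → ∃ i, eval p (pderiv i f) ≠ 0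

theorem IsRealRegular.eval_dirDeriv_ne_zero {f : MvPolynomial (Fin 3) ℝ} {d : ℕ}
    (hreg : IsRealRegular f) (hf : f.IsHomogeneous d) {e : Fin 3 → ℝ} (hyp : IsHyperbolic f e)
    {p : Fin 3 → ℝ} (hp0 : p ≠ 0) (hp : eval p f = 0) : eval p (dirDeriv e f) ≠ 0 := by
  obtain ⟨i, hi⟩ := hreg p hp0 hp
  refine hyp.eval_dirDeriv_ne_zero hf (w := Pi.single i 1) hp ?_
  simpa [eval_dirDeriv, Pi.single_apply] using hi

/-! ### Interlacing and signs -/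

theorem exists_mem_Ioo_eq_zero_of_mul_neg {u : ℝ → ℝ} {a b : ℝ} (hab : a ≤ b)
    (hu : ContinuousOn u (Set.Icc a b)) (h : u a * u b < 0) : ∃ c ∈ Set.Ioo a b, u c = 0 := by
  rcases mul_neg_iff.1 h with ⟨ha, hb⟩ | ⟨ha, hb⟩
  · exact intermediate_value_Ioo' hab hu ⟨hb, ha⟩
  · exact intermediate_value_Ioo hab hu ⟨ha, hb⟩

theorem eval_derivative_prod_X_sub_C {R : Type*} [CommRing R] {n : ℕ} (α : Fin (n + 1) → R)
    (k : Fin (n + 1)) :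
    (Polynomial.derivative (∏ i, (Polynomial.X - Polynomial.C (α i)))).eval (α k) =
      ∏ i : Fin n, (α k - α (k.succAbove i)) := by
  rw [Fin.prod_univ_succAbove _ k]
  simp [Polynomial.derivative_mul, Polynomial.eval_prod]

theorem mul_nonneg_of_interlacing {n : ℕ} {α : Fin (n + 1) → ℝ} {β : Fin n → ℝ} (hα : Monotone α)
    (h : ∀ i : Fin n, α i.castSucc ≤ β i ∧ β i ≤ α i.succ) (k : Fin (n + 1)) (i : Fin n) :
    0 ≤ (α k - α (k.succAbove i)) * (α k - β i) := by
  obtain ⟨hl, hr⟩ := h i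
  rcases lt_or_ge i.castSucc k with hk | hk
  · rw [Fin.succAbove_of_castSucc_lt _ _ hk]
    have hik : α i.succ ≤ α k := hα (Fin.castSucc_lt_iff_succ_le.1 hk)
    exact mul_nonneg (by linarith) (by linarith)
  · rw [Fin.succAbove_of_le_castSucc _ _ hk]
    have hki : α k ≤ α i.castSucc := hα hk
    exact mul_nonneg_of_nonpos_of_nonpos (by linarith) (by linarith)

theorem Interlaces.nonneg {p q : Polynomial ℝ} (h : Interlaces q p) {x : ℝ} (hx : p.eval x = 0) :
    0 ≤ p.leadingCoeff * p.derivative.eval x * (q.leadingCoeff * q.eval x) := by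
  obtain ⟨hp, -, n, α, β, hα, -, hpα, hqβ, hαβ⟩ := h
  generalize p.leadingCoeff = a at *
  generalize q.leadingCoeff = b at *
  subst hpα hqβ
  have ha : a ≠ 0 := by
    rintro rfl
    simp at hp
  obtain ⟨k, rfl⟩ : ∃ k, x = α k := by
    simpa [Polynomial.eval_prod, Finset.prod_eq_zero_iff, ha, sub_eq_zero] using hx
  have hprod : 0 ≤ ∏ i, (α k - α (k.succAbove i)) * (α k - β i) :=
    Finset.prod_nonneg fun i _ => mul_nonneg_of_interlacing hα hαβ k i
  rw [Finset.prod_mul_distrib] at hprod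
  rw [Polynomial.derivative_C_mul, Polynomial.eval_C_mul, Polynomial.eval_C_mul,
    eval_derivative_prod_X_sub_C, Polynomial.eval_prod]
  simp only [Polynomial.eval_sub, Polynomial.eval_X, Polynomial.eval_C]
  calc 0 ≤ (a * b) ^ 2 * ((∏ i, (α k - α (k.succAbove i))) * ∏ i, (α k - β i)) := by positivity
    _ = _ := by ring

theorem prod_sub_succAbove_mul_neg {n : ℕ} {α : Fin (n + 1) → ℝ} (hα : StrictMono α) (i : Fin n) :
    (∏ j, (α i.castSucc - α (i.castSucc.succAbove j))) *
      ∏ j, (α i.succ - α (i.succ.succAbove j)) < 0 := by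
  have hi : α i.castSucc < α i.succ := hα Fin.castSucc_lt_succ
  rw [← Finset.prod_mul_distrib, ← Finset.mul_prod_erase _ _ (Finset.mem_univ i)]
  refine mul_neg_of_neg_of_pos ?_ (Finset.prod_pos fun j hj => ?_)
  · rw [Fin.succAbove_castSucc_self, Fin.succAbove_succ_self]
    exact mul_neg_of_neg_of_pos (by linarith) (by linarith)
  · rcases lt_or_gt_of_ne (Finset.ne_of_mem_erase hj) with h | h
    · have hji : j.castSucc < i.castSucc := Fin.castSucc_lt_castSucc_iff.2 h
      have hlt := hα hji
      rw [Fin.succAbove_of_castSucc_lt _ _ hji,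
        Fin.succAbove_of_castSucc_lt _ _ (hji.trans Fin.castSucc_lt_succ)]
      exact mul_pos (by linarith) (by linarith)
    · have hij : i.castSucc < j.castSucc := Fin.castSucc_lt_castSucc_iff.2 h
      have hlt := hα (Fin.succ_lt_succ_iff.2 h)
      rw [Fin.succAbove_of_le_castSucc _ _ hij.le,
        Fin.succAbove_of_le_castSucc _ _ (Fin.castSucc_lt_iff_succ_le.1 hij)]
      exact mul_pos_of_neg_of_neg (by linarith) (by linarith)

theorem eq_C_mul_prod_X_sub_C_of_injective {R ι : Type*} [CommRing R] [IsDomain R] [Fintype ι]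
    {q : Polynomial R} {β : ι → R} (hβ : Function.Injective β) (hq : q.natDegree = Fintype.card ι)
    (hroot : ∀ i, q.eval (β i) = 0) :
    q = Polynomial.C q.leadingCoeff * ∏ i, (Polynomial.X - Polynomial.C (β i)) := by
  rcases eq_or_ne q 0 with rfl | hq0
  · simp
  have hle : Finset.univ.val.map β ≤ q.roots := by
    rw [Multiset.le_iff_subset (Finset.univ.nodup.map hβ)]
    intro x hx
    obtain ⟨i, -, rfl⟩ := Multiset.mem_map.1 hx
    exact (Polynomial.mem_roots hq0).2 (hroot i)
  have heq : Finset.univ.val.map β = q.roots :=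
    Multiset.eq_of_le_of_card_le hle ((Polynomial.card_roots' q).trans (by simp [hq]))
  have hcard : q.roots.card = q.natDegree := by rw [← heq, hq, Multiset.card_map]; rfl
  have hfactor := Polynomial.C_leadingCoeff_mul_prod_multiset_X_sub_C hcard
  rw [← heq, Multiset.map_map] at hfactor
  exact hfactor.symm

theorem exists_interlacing_roots_of_pos {n : ℕ} {α : Fin (n + 1) → ℝ} (hα : StrictMono α)
    {q : Polynomial ℝ} (hq : q.natDegree = n) (c : ℝ)
    (h : ∀ k, 0 < c * q.eval (α k) * ∏ i, (α k - α (k.succAbove i))) :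
    ∃ β : Fin n → ℝ, Monotone β ∧ (∀ i, α i.castSucc ≤ β i ∧ β i ≤ α i.succ) ∧
      q = Polynomial.C q.leadingCoeff * ∏ i, (Polynomial.X - Polynomial.C (β i)) := by
  have hroot (i : Fin n) : ∃ x ∈ Set.Ioo (α i.castSucc) (α i.succ), q.eval x = 0 := by
    have hneg : q.eval (α i.castSucc) * q.eval (α i.succ) < 0 := by
      have hmul := mul_pos (h i.castSucc) (h i.succ)
      have hprod := prod_sub_succAbove_mul_neg hα i
      by_contra! hq0
      nlinarith [mul_nonpos_of_nonneg_of_nonpos (mul_nonneg (sq_nonneg c) hq0) hprod.le]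
    exact exists_mem_Ioo_eq_zero_of_mul_neg (hα Fin.castSucc_lt_succ).le q.continuous.continuousOn
      hneg
  choose β hβ hβ0 using hroot
  have hmono : StrictMono β := fun i j hij =>
    (hβ i).2.trans_le ((hα.monotone (Fin.castSucc_lt_iff_succ_le.1
      (Fin.castSucc_lt_castSucc_iff.2 hij))).trans (hβ j).1.le)
  exact ⟨β, hmono.monotone, fun i => ⟨(hβ i).1.le, (hβ i).2.le⟩,
    eq_C_mul_prod_X_sub_C_of_injective hmono.injective (by rw [hq, Fintype.card_fin]) hβ0⟩

open Filter Topology in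
theorem exists_mem_eq_C_mul_prod_X_sub_C_of_tendsto {𝕜 ι J : Type*} [Field 𝕜] [Infinite 𝕜]
    [TopologicalSpace 𝕜] [IsTopologicalRing 𝕜] [T2Space 𝕜] [Fintype ι] {K : Set (ι → 𝕜)}
    (hK : IsCompact K) {l : Filter J} [l.NeBot] {q : J → Polynomial 𝕜} {c : J → 𝕜}
    {β : J → ι → 𝕜} (hβ : ∀ᶠ j in l, β j ∈ K)
    (hq : ∀ᶠ j in l, q j = Polynomial.C (c j) * ∏ i, (Polynomial.X - Polynomial.C (β j i)))
    {q₀ : Polynomial 𝕜} {c₀ : 𝕜} (hc : Tendsto c l (𝓝 c₀))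
    (hlim : ∀ x, Tendsto (fun j => (q j).eval x) l (𝓝 (q₀.eval x))) :
    ∃ b ∈ K, q₀ = Polynomial.C c₀ * ∏ i, (Polynomial.X - Polynomial.C (b i)) := by
  set u := Ultrafilter.of l
  have hul : (u : Filter J) ≤ l := Ultrafilter.of_le l
  obtain ⟨b, hbK, hb⟩ := hK.ultrafilter_le_nhds (u.map β) (by
    rw [le_principal_iff]
    exact hul hβ)
  have hb : ∀ i, Tendsto (fun j => β j i) u (𝓝 (b i)) := tendsto_pi_nhds.1 hb
  refine ⟨b, hbK, Polynomial.funext fun x => ?_⟩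
  refine tendsto_nhds_unique ((hlim x).mono_left hul) ?_
  have hprod : Tendsto (fun j => c j * ∏ i, (x - β j i)) u (𝓝 (c₀ * ∏ i, (x - b i))) :=
    (hc.mono_left hul).mul (tendsto_finsetProd _ fun i _ => tendsto_const_nhds.sub (hb i))
  have hlimit : (Polynomial.C c₀ * ∏ i, (Polynomial.X - Polynomial.C (b i))).eval x =
      c₀ * ∏ i, (x - b i) := by simp [Polynomial.eval_prod]
  rw [hlimit]
  refine hprod.congr' ?_
  filter_upwards [hul hq] with j hj
  simp [hj, Polynomial.eval_prod]

theorem mul_eval_add_derivative_pos {n : ℕ} {α : Fin (n + 1) → ℝ} (hα : Function.Injective α)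
    {q : Polynomial ℝ} {c ε : ℝ} (hc : c ≠ 0) (hε : 0 < ε) {k : Fin (n + 1)}
    (h : 0 ≤ c * q.eval (α k) * ∏ i, (α k - α (k.succAbove i))) :
    0 < c * (q + Polynomial.C (ε * c) *
      Polynomial.derivative (∏ i, (Polynomial.X - Polynomial.C (α i)))).eval (α k) *
        ∏ i, (α k - α (k.succAbove i)) := by
  have hne : ∏ i, (α k - α (k.succAbove i)) ≠ 0 := Finset.prod_ne_zero_iff.2 fun i _ =>
    sub_ne_zero.2 (hα.ne (Fin.succAbove_ne k i).symm)
  have hsq : 0 < ε * (c * ∏ i, (α k - α (k.succAbove i))) ^ 2 := by positivity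
  rw [Polynomial.eval_add, Polynomial.eval_C_mul, eval_derivative_prod_X_sub_C]
  linarith

open Filter Topology in
theorem exists_interlacing_roots {n : ℕ} {α : Fin (n + 1) → ℝ} (hα : StrictMono α)
    {q : Polynomial ℝ} (hq : q.natDegree = n) (hq0 : q ≠ 0)
    (h : ∀ k, 0 ≤ q.leadingCoeff * q.eval (α k) * ∏ i, (α k - α (k.succAbove i))) :
    ∃ β : Fin n → ℝ, Monotone β ∧ (∀ i, α i.castSucc ≤ β i ∧ β i ≤ α i.succ) ∧
      q = Polynomial.C q.leadingCoeff * ∏ i, (Polynomial.X - Polynomial.C (β i)) := by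
  set r : Polynomial ℝ := Polynomial.derivative (∏ i, (Polynomial.X - Polynomial.C (α i)))
  set c := q.leadingCoeff with hcdef
  have hc : c ≠ 0 := Polynomial.leadingCoeff_ne_zero.2 hq0
  have hrdeg : r.natDegree ≤ n := by
    refine (Polynomial.natDegree_derivative_le _).trans ?_
    simp
  have hcoeff (ε : ℝ) : (q + Polynomial.C (ε * c) * r).coeff n = c + ε * c * r.coeff n := by
    rw [Polynomial.coeff_add, Polynomial.coeff_C_mul, hcdef, Polynomial.leadingCoeff, hq]
  have hclim : Tendsto (fun ε : ℝ => c + ε * c * r.coeff n) (𝓝[>] 0) (𝓝 c) := by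
    have : Continuous fun ε : ℝ => c + ε * c * r.coeff n := by fun_prop
    simpa using (this.tendsto 0).mono_left nhdsWithin_le_nhds
  set K := Set.Icc (fun i : Fin n => α i.castSucc) (fun i => α i.succ) ∩ {β | Monotone β}
  have hfactor : ∀ᶠ ε in 𝓝[>] (0 : ℝ), ∃ β ∈ K, q + Polynomial.C (ε * c) * r =
      Polynomial.C (c + ε * c * r.coeff n) * ∏ i, (Polynomial.X - Polynomial.C (β i)) := by
    filter_upwards [self_mem_nhdsWithin, hclim.eventually_ne hc] with ε hε hne
    have hdeg : (q + Polynomial.C (ε * c) * r).natDegree = n :=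
      Polynomial.natDegree_eq_of_le_of_coeff_ne_zero (Polynomial.natDegree_add_le_of_degree_le
        hq.le ((Polynomial.natDegree_C_mul_le _ _).trans hrdeg)) (by rwa [hcoeff])
    obtain ⟨β, hβ, hαβ, hβq⟩ := exists_interlacing_roots_of_pos hα hdeg c
      fun k => mul_eval_add_derivative_pos hα.injective hc hε (h k)
    rw [Polynomial.leadingCoeff, hdeg, hcoeff] at hβq
    exact ⟨β, ⟨⟨fun i => (hαβ i).1, fun i => (hαβ i).2⟩, hβ⟩, hβq⟩
  obtain ⟨β, hβ⟩ := hfactor.choice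
  obtain ⟨b, ⟨⟨hb₁, hb₂⟩, hb⟩, hqb⟩ := exists_mem_eq_C_mul_prod_X_sub_C_of_tendsto
    (isCompact_Icc.inter_right isClosed_monotone) (hβ.mono fun _ h => h.1)
    (hβ.mono fun _ h => h.2) hclim (q₀ := q) fun x => by
      have : Continuous fun ε : ℝ => (q + Polynomial.C (ε * c) * r).eval x := by
        simp only [Polynomial.eval_add, Polynomial.eval_C_mul]
        fun_prop
      simpa using (this.tendsto 0).mono_left nhdsWithin_le_nhds
  exact ⟨b, hb, fun i => ⟨hb₁ i, hb₂ i⟩, hqb⟩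

theorem exists_strictMono_roots {K : Type*} [Field K] [LinearOrder K] {p : Polynomial K}
    (hp : p.Splits) {n : ℕ} (hn : p.natDegree = n)
    (hsimple : ∀ x, p.eval x = 0 → p.derivative.eval x ≠ 0) :
    ∃ α : Fin n → K, StrictMono α ∧
      p = Polynomial.C p.leadingCoeff * ∏ i, (Polynomial.X - Polynomial.C (α i)) := by
  have hp0 : p ≠ 0 := by
    rintro rfl
    simpa using hsimple 0
  have hnodup : p.roots.Nodup := by
    rw [Multiset.nodup_iff_count_le_one]
    intro x
    rw [Polynomial.count_roots]
    by_contra! h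
    have hroot := (Polynomial.one_lt_rootMultiplicity_iff_isRoot hp0).1 h
    exact hsimple x hroot.1 hroot.2
  have hcard : p.roots.toFinset.card = n := by
    rw [Multiset.toFinset_card_of_nodup hnodup, ← hp.natDegree_eq_card_roots, hn]
  set α := p.roots.toFinset.orderEmbOfFin hcard
  have hprod : ∏ i, (Polynomial.X - Polynomial.C (α i)) =
      ∏ x ∈ p.roots.toFinset, (Polynomial.X - Polynomial.C x) := by
    conv_rhs => rw [← Finset.map_orderEmbOfFin_univ p.roots.toFinset hcard, Finset.prod_map]
    rfl
  refine ⟨α, α.strictMono, ?_⟩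
  rw [hprod, Finset.prod, Multiset.toFinset_val, hnodup.dedup]
  exact hp.eq_prod_roots

theorem interlaces_of_nonneg {p q : Polynomial ℝ} (hp : p.Splits)
    (hsimple : ∀ x, p.eval x = 0 → p.derivative.eval x ≠ 0) (hq0 : q ≠ 0)
    (hdeg : q.natDegree + 1 = p.natDegree)
    (h : ∀ x, p.eval x = 0 →
      0 ≤ p.leadingCoeff * p.derivative.eval x * (q.leadingCoeff * q.eval x)) :
    Interlaces q p := by
  obtain ⟨α, hα, hpα⟩ := exists_strictMono_roots hp hdeg.symm hsimple
  have hp0 : p ≠ 0 := by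
    rintro rfl
    simp at hdeg
  have hsign (k : Fin (q.natDegree + 1)) :
      0 ≤ q.leadingCoeff * q.eval (α k) * ∏ i, (α k - α (k.succAbove i)) := by
    have hroot : p.eval (α k) = 0 := by
      rw [hpα, Polynomial.eval_C_mul, Polynomial.eval_prod,
        Finset.prod_eq_zero (Finset.mem_univ k) (by simp), mul_zero]
    have hderiv : p.derivative.eval (α k) = p.leadingCoeff * ∏ i, (α k - α (k.succAbove i)) := by
      conv_lhs => rw [hpα]
      rw [Polynomial.derivative_C_mul, Polynomial.eval_C_mul, eval_derivative_prod_X_sub_C]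
    have hlead : 0 < p.leadingCoeff ^ 2 := by
      have := Polynomial.leadingCoeff_ne_zero.2 hp0
      positivity
    refine nonneg_of_mul_nonneg_right (a := p.leadingCoeff ^ 2) ?_ hlead
    have := h (α k) hroot
    rw [hderiv] at this
    linarith
  obtain ⟨β, hβ, hαβ, hqβ⟩ := exists_interlacing_roots hα rfl hq0 hsign
  exact ⟨hp0, hq0, q.natDegree, α, β, hα.monotone, hβ, hpα, hqβ, hαβ⟩

theorem interlaces_C_mul_X_sub_C_pow {a b : ℝ} (ha : a ≠ 0) (hb : b ≠ 0) (x : ℝ) (n : ℕ) :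
    Interlaces (Polynomial.C b * (Polynomial.X - Polynomial.C x) ^ n)
      (Polynomial.C a * (Polynomial.X - Polynomial.C x) ^ (n + 1)) := by
  have hmonic (k : ℕ) : ((Polynomial.X - Polynomial.C x) ^ k).leadingCoeff = 1 :=
    ((Polynomial.monic_X_sub_C x).pow k).leadingCoeff
  refine ⟨mul_ne_zero (Polynomial.C_ne_zero.2 ha) (pow_ne_zero _ (Polynomial.X_sub_C_ne_zero x)),
    mul_ne_zero (Polynomial.C_ne_zero.2 hb) (pow_ne_zero _ (Polynomial.X_sub_C_ne_zero x)),
    n, fun _ => x, fun _ => x, monotone_const, monotone_const, ?_, ?_,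
    fun _ => ⟨le_rfl, le_rfl⟩⟩ <;>
  simp [hmonic]

section InterlacerCone

variable {f g : MvPolynomial (Fin 3) ℝ} {d : ℕ} {e : Fin 3 → ℝ}

theorem restrictLine_smul (hf : f.IsHomogeneous d) (e : Fin 3 → ℝ) (c : ℝ) :
    restrictLine f e (c • e) =
      Polynomial.C (eval e f) * (Polynomial.X - Polynomial.C (-c)) ^ d := by
  refine Polynomial.funext fun t => ?_
  rw [eval_restrictLine, ← add_smul, eval_smul_of_isHomogeneous hf]
  simp [mul_comm]

theorem mul_eval_nonneg_of_mem_interlacerCone (hf : f.IsHomogeneous d) (hyp : IsHyperbolic f e)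
    (hg : g ∈ interlacerCone d f e) {p : Fin 3 → ℝ} (hp : eval p f = 0) :
    0 ≤ eval e f * eval p (dirDeriv e f) * eval p g := by
  obtain ⟨hgd, hint, hge⟩ := hg
  have hsign := (hint p).nonneg (x := 0) (by simp [eval_restrictLine, hp])
  rw [leadingCoeff_restrictLine hf hyp.1, leadingCoeff_restrictLine hgd hge.ne',
    derivative_restrictLine] at hsign
  simp only [eval_restrictLine, zero_smul, zero_add] at hsign
  refine nonneg_of_mul_nonneg_left (b := eval e g) ?_ hge
  linarith

theorem mem_interlacerCone_of_mul_eval_nonneg (hd : 1 ≤ d) (hf : f.IsHomogeneous d)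
    (hyp : IsHyperbolic f e)
    (htrans : ∀ p, p ≠ 0 → eval p f = 0 → eval p (dirDeriv e f) ≠ 0)
    (hg : g.IsHomogeneous (d - 1)) (hge : 0 < eval e g)
    (hsign : ∀ p, p ≠ 0 → eval p f = 0 → 0 ≤ eval e f * eval p (dirDeriv e f) * eval p g) :
    g ∈ interlacerCone d f e := by
  obtain ⟨n, rfl⟩ : ∃ n, d = n + 1 := ⟨d - 1, by omega⟩
  rw [Nat.add_sub_cancel] at hg
  refine ⟨hg, fun v => ?_, hge⟩
  by_cases hv : ∃ c : ℝ, v = c • e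
  · obtain ⟨c, rfl⟩ := hv
    rw [restrictLine_smul hf, restrictLine_smul hg]
    exact interlaces_C_mul_X_sub_C_pow hyp.1 hge.ne' (-c) n
  · have hne (t : ℝ) : t • e + v ≠ 0 := fun h0 =>
      hv ⟨-t, by rw [neg_smul, eq_neg_of_add_eq_zero_right h0]⟩
    have hg0 : restrictLine g e v ≠ 0 := by
      rw [← Polynomial.leadingCoeff_ne_zero, leadingCoeff_restrictLine hg hge.ne']
      exact hge.ne'
    refine interlaces_of_nonneg (hyp.2 v) (fun t ht => ?_) hg0 ?_ fun t ht => ?_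
    · rw [eval_restrictLine] at ht
      rw [derivative_restrictLine, eval_restrictLine]
      exact htrans _ (hne t) ht
    · rw [natDegree_restrictLine hg hge.ne', natDegree_restrictLine hf hyp.1]
    · rw [eval_restrictLine] at ht
      rw [leadingCoeff_restrictLine hf hyp.1, leadingCoeff_restrictLine hg hge.ne',
        derivative_restrictLine, eval_restrictLine, eval_restrictLine]
      have := mul_nonneg hge.le (hsign _ (hne t) ht)
      linarith

end InterlacerCone

/-! ### Smooth plane curves are irreducible -/

section HomogeneousFactors

variable {σ R : Type*} [CommRing R]

/-- The homomorphism `p ↦ p(T x)` that multiplies all variables by a new variable `T`; the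
coefficient of `T ^ n` in the image of `p` is the homogeneous component of `p` of degree `n`. -/
def scaleVars (σ R : Type*) [CommRing R] : MvPolynomial σ R →ₐ[R] Polynomial (MvPolynomial σ R) :=
  aeval ((Polynomial.X : Polynomial (MvPolynomial σ R)) • fun i => Polynomial.C (X i))

theorem scaleVars_of_isHomogeneous {p : MvPolynomial σ R} {n : ℕ} (hp : p.IsHomogeneous n) :
    scaleVars σ R p = Polynomial.monomial n p := by
  have hC : aeval (fun i : σ => (Polynomial.C (X i) : Polynomial (MvPolynomial σ R))) p =
      Polynomial.C p := by
    have := aeval_algebraMap_apply (Polynomial (MvPolynomial σ R)) (X : σ → MvPolynomial σ R) p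
    simpa [aeval_X_left, Function.comp_def] using this
  rw [scaleVars, aeval_smul_of_isHomogeneous hp, hC, mul_comm, Polynomial.C_mul_X_pow_eq_monomial]

theorem coeff_scaleVars (p : MvPolynomial σ R) (n : ℕ) :
    (scaleVars σ R p).coeff n = homogeneousComponent n p := by
  conv_lhs => rw [← sum_homogeneousComponent p, map_sum, Polynomial.finsetSum_coeff]
  simp_rw [scaleVars_of_isHomogeneous (homogeneousComponent_isHomogeneous _ p),
    Polynomial.coeff_monomial]
  rw [Finset.sum_ite_eq']
  split_ifs with h
  · rfl
  · exact (homogeneousComponent_eq_zero _ _ (by rw [Finset.mem_range] at h; omega)).symm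

theorem eval_one_scaleVars (p : MvPolynomial σ R) : (scaleVars σ R p).eval 1 = p := by
  induction p using MvPolynomial.induction_on with
  | C a => simp [scaleVars, MvPolynomial.algebraMap_eq]
  | add p q hp hq => rw [map_add, Polynomial.eval_add, hp, hq]
  | mul_X p i hp => rw [map_mul, Polynomial.eval_mul, hp]; simp [scaleVars]

theorem isHomogeneous_of_natDegree_le_natTrailingDegree {p : MvPolynomial σ R}
    (h : (scaleVars σ R p).natDegree ≤ (scaleVars σ R p).natTrailingDegree) :
    p.IsHomogeneous (scaleVars σ R p).natDegree := by
  set P := scaleVars σ R p with hP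
  have hp : p = P.coeff P.natDegree := by
    conv_lhs => rw [← eval_one_scaleVars p, ← hP, Polynomial.eval_eq_sum_range]
    rw [Finset.sum_eq_single_of_mem P.natDegree (by simp) fun i hi hne => ?_, one_pow, mul_one]
    rw [Polynomial.coeff_eq_zero_of_lt_natTrailingDegree, zero_mul]
    rw [Finset.mem_range] at hi
    omega
  nth_rw 1 [hp]
  rw [hP, coeff_scaleVars]
  exact homogeneousComponent_isHomogeneous _ _

theorem exists_isHomogeneous_of_mul_isHomogeneous [IsDomain R] {a b : MvPolynomial σ R} {d : ℕ}
    (h : (a * b).IsHomogeneous d) (h0 : a * b ≠ 0) :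
    ∃ k l, a.IsHomogeneous k ∧ b.IsHomogeneous l := by
  have hne {p : MvPolynomial σ R} (hp : p ≠ 0) : scaleVars σ R p ≠ 0 := fun h1 =>
    hp (by rw [← eval_one_scaleVars p, h1, Polynomial.eval_zero])
  have ha := hne (left_ne_zero_of_mul h0)
  have hb := hne (right_ne_zero_of_mul h0)
  have hab : scaleVars σ R a * scaleVars σ R b = Polynomial.monomial d (a * b) := by
    rw [← map_mul, scaleVars_of_isHomogeneous h]
  have hdeg := Polynomial.natDegree_mul ha hb
  have htrail := Polynomial.natTrailingDegree_mul ha hb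
  rw [hab, Polynomial.natDegree_monomial_eq _ h0] at hdeg
  rw [hab, Polynomial.natTrailingDegree_monomial h0] at htrail
  have hlea := Polynomial.natTrailingDegree_le_natDegree (scaleVars σ R a)
  have hleb := Polynomial.natTrailingDegree_le_natDegree (scaleVars σ R b)
  exact ⟨_, _, isHomogeneous_of_natDegree_le_natTrailingDegree (by omega),
    isHomogeneous_of_natDegree_le_natTrailingDegree (by omega)⟩

end HomogeneousFactors

section CoordIdeal

variable {σ : Type*} [DecidableEq σ]

/-- The ideal generated by the variables in `s`, as the kernel of setting these variables to zero;
in this form it is visibly prime. -/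
def coordIdeal (R : Type*) [CommRing R] (s : Finset σ) : Ideal (MvPolynomial σ R) :=
  RingHom.ker (aeval fun i => if i ∈ s then 0 else X i : MvPolynomial σ R →ₐ[R] MvPolynomial σ R)

instance {R : Type*} [CommRing R] [IsDomain R] (s : Finset σ) : (coordIdeal R s).IsPrime :=
  RingHom.ker_isPrime _

theorem X_mem_coordIdeal {R : Type*} [CommRing R] [Nontrivial R] {s : Finset σ} {i : σ} :
    (X i : MvPolynomial σ R) ∈ coordIdeal R s ↔ i ∈ s := by
  rw [coordIdeal, RingHom.mem_ker]
  by_cases h : i ∈ s <;> simp [h]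

theorem coordIdeal_mono {R : Type*} [CommRing R] {s t : Finset σ} (h : s ⊆ t) :
    coordIdeal R s ≤ coordIdeal R t := by
  intro p hp
  have hcomp :
      (aeval fun i => if i ∈ t then 0 else X i : MvPolynomial σ R →ₐ[R] MvPolynomial σ R) =
        (aeval fun i => if i ∈ t then 0 else X i : MvPolynomial σ R →ₐ[R] MvPolynomial σ R).comp
          (aeval fun i => if i ∈ s then 0 else X i) := by
    ext i : 1
    by_cases hi : i ∈ s
    · simp [hi, h hi]
    · simp [hi]
  rw [coordIdeal, RingHom.mem_ker] at hp ⊢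
  rw [hcomp, AlgHom.comp_apply, hp, map_zero]

theorem card_le_height_coordIdeal {R : Type*} [CommRing R] [IsDomain R] [IsNoetherianRing R]
    [Finite σ] (s : Finset σ) :
    (s.card : ℕ∞) ≤ (coordIdeal R s).height := by
  induction s using Finset.induction_on with
  | empty => simp
  | insert a s ha ih =>
    have hlt : coordIdeal R s < coordIdeal R (insert a s) := by
      refine (coordIdeal_mono (Finset.subset_insert a s)).lt_of_ne fun heq => ha ?_
      rw [← X_mem_coordIdeal (R := R), heq, X_mem_coordIdeal]
      exact Finset.mem_insert_self a s
    rw [Finset.card_insert_of_notMem ha, Nat.cast_add_one]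
    exact (by gcongr : _ ≤ (coordIdeal R s).height + 1).trans
      (Order.add_one_le_of_lt (Ideal.height_strict_mono_of_isPrime_of_isPrime hlt))

end CoordIdeal

theorem exists_ne_zero_forall_eval_eq_zero {σ K : Type*} [Fintype σ] [Field K] [IsAlgClosed K]
    (S : Finset (MvPolynomial σ K)) (hS : S.card < Fintype.card σ)
    (h0 : ∀ p ∈ S, eval 0 p = 0) : ∃ v : σ → K, v ≠ 0 ∧ ∀ p ∈ S, eval v p = 0 := by
  classical
  by_contra! hno
  have hZ : zeroLocus K (Ideal.span (S : Set (MvPolynomial σ K))) = {0} := by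
    rw [zeroLocus_span]
    ext v
    simp only [Set.mem_ofPred_eq, aeval_eq_eval, Set.mem_singleton_iff]
    refine ⟨fun hv => ?_, fun hv => hv ▸ h0⟩
    by_contra hv0
    obtain ⟨p, hp, hne⟩ := hno v hv0
    exact hne (hv p hp)
  have hrad := vanishingIdeal_zeroLocus_eq_radical (k := K) (K := K)
    (Ideal.span (S : Set (MvPolynomial σ K)))
  rw [hZ] at hrad
  have hmin : vanishingIdeal K {(0 : σ → K)} ∈
      (Ideal.span (S : Set (MvPolynomial σ K))).minimalPrimes := by
    rw [← Ideal.radical_minimalPrimes, ← hrad, Ideal.minimalPrimes_eq_subsingleton_self]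
    rfl
  have hle : coordIdeal K Finset.univ ≤ vanishingIdeal K {(0 : σ → K)} := by
    intro p hp
    rw [coordIdeal, RingHom.mem_ker] at hp
    rw [mem_vanishingIdeal_singleton_iff]
    have := congrArg (eval (0 : σ → K)) hp
    rw [map_aeval] at this
    simpa [aeval_def, Pi.zero_def] using this
  have hheight := ((card_le_height_coordIdeal Finset.univ).trans (Ideal.height_mono hle)).trans
    (Ideal.height_le_card_of_mem_minimalPrimes_span S.finite_toSet hmin)
  rw [Finset.card_univ, Set.ncard_coe_finset, Nat.cast_le] at hheight
  omega

theorem isUnit_of_isHomogeneous_zero {σ K : Type*} [Field K] {p : MvPolynomial σ K}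
    (hp0 : p ≠ 0) (hp : p.IsHomogeneous 0) : IsUnit p := by
  rw [← totalDegree_zero_iff_isHomogeneous, totalDegree_eq_zero_iff_eq_C] at hp
  rw [hp]
  refine (IsUnit.mk0 _ fun h => hp0 ?_).map C
  rw [hp, h, C_0]

theorem IsSmoothCurve.irreducible {f : MvPolynomial (Fin 3) ℝ} {d : ℕ} (hs : IsSmoothCurve f)
    (hd : 1 ≤ d) (hf : f.IsHomogeneous d) (hf0 : f ≠ 0) : Irreducible f := by
  refine ⟨fun hu => ?_, fun a b hab => ?_⟩
  · have := (isUnit_iff_totalDegree_of_isReduced.1 hu).2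
    rw [hf.totalDegree hf0] at this
    omega
  · subst hab
    obtain ⟨k, l, ha, hb⟩ := exists_isHomogeneous_of_mul_isHomogeneous hf hf0
    by_contra! hcon
    have hk : k ≠ 0 := by
      rintro rfl
      exact hcon.1 (isUnit_of_isHomogeneous_zero (left_ne_zero_of_mul hf0) ha)
    have hl : l ≠ 0 := by
      rintro rfl
      exact hcon.2 (isUnit_of_isHomogeneous_zero (right_ne_zero_of_mul hf0) hb)
    have h0 {c : MvPolynomial (Fin 3) ℝ} {n : ℕ} (hc : c.IsHomogeneous n) (hn : n ≠ 0) :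
        aeval (0 : Fin 3 → ℂ) c = 0 := by
      simpa [hn] using aeval_smul_of_isHomogeneous hc (0 : ℂ) 0
    obtain ⟨v, hv, hzero⟩ := exists_ne_zero_forall_eval_eq_zero
      {map (algebraMap ℝ ℂ) a, map (algebraMap ℝ ℂ) b}
      (Finset.card_le_two.trans_lt (by simp)) (by
        simp only [Finset.mem_insert, Finset.mem_singleton, forall_eq_or_imp, forall_eq, eval_map,
          ← aeval_def]
        exact ⟨h0 ha hk, h0 hb hl⟩)
    simp only [Finset.mem_insert, Finset.mem_singleton, forall_eq_or_imp, forall_eq, eval_map,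
      ← aeval_def] at hzero
    obtain ⟨hva, hvb⟩ := hzero
    obtain ⟨i, hi⟩ := hs v hv (by rw [map_mul, hva, zero_mul])
    refine hi ?_
    rw [pderiv_mul, map_add, map_mul, map_mul, hva, hvb, mul_zero, zero_mul, add_zero]

theorem IsSmoothCurve.isRealRegular {f : MvPolynomial (Fin 3) ℝ} (hs : IsSmoothCurve f) :
    IsRealRegular f := by
  intro p hp0 hp
  have hcast (q : MvPolynomial (Fin 3) ℝ) : aeval (fun i => (p i : ℂ)) q = (eval p q : ℂ) := by
    simpa [aeval_eq_eval, Function.comp_def] using aeval_algebraMap_apply (A := ℝ) ℂ p q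
  obtain ⟨i, hi⟩ := hs (fun i => (p i : ℂ))
    (fun h => hp0 (funext fun i => by simpa using congrFun h i)) (by simp [hcast, hp])
  exact ⟨i, by simpa [hcast] using hi⟩

/-! ### Local algebra at a regular point of a plane curve -/

section PowersOfParameter

variable {K A : Type*} [Field K] [CommRing A] [Algebra K A]

open Pointwise in
theorem finrank_quotient_span_mul {a b : A} (hb : b ∈ nonZeroDivisors A)
    [Module.Finite K (A ⧸ Ideal.span {a})] [Module.Finite K (A ⧸ Ideal.span {b})] :
    Module.Finite K (A ⧸ Ideal.span {b * a}) ∧ Module.finrank K (A ⧸ Ideal.span {b * a}) =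
      Module.finrank K (A ⧸ Ideal.span {b}) + Module.finrank K (A ⧸ Ideal.span {a}) := by
  have hspan : b • Ideal.span {a} = Ideal.span {b * a} := by
    rw [← Submodule.singleton_set_smul, ← Ideal.submodule_span_eq, ← Ideal.submodule_span_eq,
      Submodule.set_smul_span]
    simp
  rw [← hspan]
  set μ := (Ideal.mulQuot b (Ideal.span {a})).restrictScalars K
  set q := (Ideal.quotOfMul b (Ideal.span {a})).restrictScalars K
  have hexact : Function.Exact μ q := Ideal.exact_mulQuot_quotOfMul _
  have hq : Function.Surjective q := Ideal.quotOfMul_surjective _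
  have hμ : Function.Injective μ := Ideal.mulQuot_injective _ hb
  have hfin := Module.Finite.of_exact hexact hq
  refine ⟨hfin, ?_⟩
  rw [← q.finrank_range_add_finrank_ker, LinearMap.range_eq_top.2 hq, finrank_top,
    hexact.linearMap_ker_eq, LinearMap.finrank_range_of_inj hμ]

theorem finrank_quotient_span_pow {t : A} (ht : t ∈ nonZeroDivisors A)
    [Module.Finite K (A ⧸ Ideal.span {t})] (n : ℕ) :
    Module.Finite K (A ⧸ Ideal.span {t ^ n}) ∧
      Module.finrank K (A ⧸ Ideal.span {t ^ n}) = n * Module.finrank K (A ⧸ Ideal.span {t}) := by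
  induction n with
  | zero =>
    have : Subsingleton (A ⧸ Ideal.span {t ^ 0}) :=
      Ideal.Quotient.subsingleton_iff.2 (by rw [pow_zero, Ideal.span_singleton_one])
    exact ⟨inferInstance, by rw [Module.finrank_zero_of_subsingleton, zero_mul]⟩
  | succ n ih =>
    have := ih.1
    obtain ⟨hfin, hrank⟩ := finrank_quotient_span_mul (K := K) (a := t ^ n) ht
    rw [pow_succ']
    exact ⟨hfin, by rw [hrank, ih.2]; ring⟩

variable (K) in
/-- Quotienting by `x` and then by `y` is quotienting by both. -/
def quotQuotSpanPairEquiv (x y : A) :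
    ((A ⧸ Ideal.span {x}) ⧸ Ideal.span {Ideal.Quotient.mk (Ideal.span {x}) y}) ≃ₐ[K]
      A ⧸ Ideal.span {x, y} :=
  (Ideal.quotientEquivAlgOfEq K (by
    rw [Ideal.map_span, Set.image_singleton, Ideal.Quotient.mkₐ_eq_mk])).trans
    ((DoubleQuot.quotQuotEquivQuotSupₐ K (Ideal.span {x}) (Ideal.span {y})).trans
      (Ideal.quotientEquivAlgOfEq K (Ideal.span_insert _ _).symm))

variable [IsLocalRing A]

theorem isLocalRing_quotient_of_maximalIdeal_eq_span_pair {x l : A}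
    (hmax : IsLocalRing.maximalIdeal A = Ideal.span {x, l}) :
    ∃ _ : IsLocalRing (A ⧸ Ideal.span {x}), IsLocalRing.maximalIdeal (A ⧸ Ideal.span {x}) =
      Ideal.span {Ideal.Quotient.mk (Ideal.span {x}) l} := by
  have hle : Ideal.span {x} ≤ IsLocalRing.maximalIdeal A :=
    hmax ▸ Ideal.span_mono (by simp)
  have : Nontrivial (A ⧸ Ideal.span {x}) := Ideal.Quotient.nontrivial_iff.2
    (ne_top_of_le_ne_top Ideal.IsPrime.ne_top' hle)
  have hlocal : IsLocalRing (A ⧸ Ideal.span {x}) :=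
    .of_surjective' (Ideal.Quotient.mk _) Ideal.Quotient.mk_surjective
  refine ⟨hlocal, ?_⟩
  rw [← IsLocalRing.map_maximalIdeal_of_surjective _ Ideal.Quotient.mk_surjective, hmax,
    Ideal.map_span, Set.image_pair, Ideal.Quotient.mk_singleton_self, Ideal.span_insert_zero]

theorem finrank_residue_eq_one
    (hres : ∀ y : A, ∃ c : K, y - algebraMap K A c ∈ IsLocalRing.maximalIdeal A) :
    Module.finrank K (A ⧸ IsLocalRing.maximalIdeal A) = 1 := by
  rw [finrank_eq_one_iff_of_nonzero' 1 one_ne_zero]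
  intro y
  obtain ⟨y, rfl⟩ := Ideal.Quotient.mk_surjective y
  obtain ⟨c, hc⟩ := hres y
  refine ⟨c, ?_⟩
  rw [Algebra.smul_def, mul_one]
  exact (Ideal.Quotient.eq.2 hc).symm

variable [IsNoetherianRing A]

theorem exists_isUnit_eq_mul_pow {t g : A} (ht : IsLocalRing.maximalIdeal A = Ideal.span {t})
    (hg : g ≠ 0) : ∃ (m : ℕ) (u : A), IsUnit u ∧ g = u * t ^ m := by
  have hfin : FiniteMultiplicity t g := by
    by_contra hinf
    rw [FiniteMultiplicity, not_exists_not] at hinf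
    refine hg ?_
    rw [← Ideal.mem_bot, ← Ideal.iInf_pow_eq_bot_of_isLocalRing (IsLocalRing.maximalIdeal A)
      Ideal.IsPrime.ne_top', Ideal.mem_iInf]
    intro n
    rw [ht, Ideal.span_singleton_pow, Ideal.mem_span_singleton]
    exact (pow_dvd_pow t n.le_succ).trans (hinf n)
  obtain ⟨u, hu, hndvd⟩ := hfin.exists_eq_pow_mul_and_not_dvd
  refine ⟨multiplicity t g, u, ?_, by rw [mul_comm, ← hu]⟩
  rwa [← Ideal.mem_span_singleton, ← ht, IsLocalRing.mem_maximalIdeal, mem_nonunits_iff,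
    not_not] at hndvd

theorem mem_nonZeroDivisors_of_not_isNilpotent {t : A}
    (ht : IsLocalRing.maximalIdeal A = Ideal.span {t}) (hnil : ¬ IsNilpotent t) :
    t ∈ nonZeroDivisors A := by
  rw [mem_nonZeroDivisors_iff_right]
  intro y hy
  by_contra h
  obtain ⟨m, u, hu, rfl⟩ := exists_isUnit_eq_mul_pow ht h
  rw [mul_assoc, ← pow_succ, hu.mul_right_eq_zero] at hy
  exact hnil ⟨m + 1, hy⟩

theorem exists_isUnit_dvd_sub_mul_pow {x l g : A}
    (hmax : IsLocalRing.maximalIdeal A = Ideal.span {x, l}) (hg : ¬ x ∣ g) :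
    ∃ (m : ℕ) (u : A), IsUnit u ∧ x ∣ g - u * l ^ m := by
  obtain ⟨_, hmax'⟩ := isLocalRing_quotient_of_maximalIdeal_eq_span_pair hmax
  obtain ⟨m, u, hu, hgu⟩ := exists_isUnit_eq_mul_pow
    (g := Ideal.Quotient.mk (Ideal.span {x}) g) hmax'
    (by rwa [Ne, Ideal.Quotient.eq_zero_iff_mem, Ideal.mem_span_singleton])
  obtain ⟨u, rfl⟩ := Ideal.Quotient.mk_surjective u
  have : IsLocalHom (Ideal.Quotient.mk (Ideal.span {x})) :=
    .of_surjective _ Ideal.Quotient.mk_surjective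
  refine ⟨m, u, isUnit_of_map_unit _ u hu, ?_⟩
  rw [← Ideal.mem_span_singleton, ← Ideal.Quotient.eq, hgu, map_mul, map_pow]

theorem finrank_quotient_span_pair {x l g u : A} {m : ℕ}
    (hmax : IsLocalRing.maximalIdeal A = Ideal.span {x, l})
    (hres : ∀ y : A, ∃ c : K, y - algebraMap K A c ∈ IsLocalRing.maximalIdeal A)
    (hl : ∀ n, ¬ x ∣ l ^ n) (hu : IsUnit u) (hg : x ∣ g - u * l ^ m) :
    Module.Finite K (A ⧸ Ideal.span {x, g}) ∧ Module.finrank K (A ⧸ Ideal.span {x, g}) = m := by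
  obtain ⟨_, hmax'⟩ := isLocalRing_quotient_of_maximalIdeal_eq_span_pair hmax
  have hreg := mem_nonZeroDivisors_of_not_isNilpotent hmax' (by
    rintro ⟨n, hn⟩
    rw [← map_pow, Ideal.Quotient.eq_zero_iff_mem, Ideal.mem_span_singleton] at hn
    exact hl n hn)
  set B := A ⧸ Ideal.span {x}
  set t := Ideal.Quotient.mk (Ideal.span {x}) l with ht
  have hone : Module.finrank K (B ⧸ Ideal.span {t}) = 1 := by
    rw [(quotQuotSpanPairEquiv K x l).toLinearEquiv.finrank_eq, ← hmax,
      finrank_residue_eq_one hres]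
  have := Module.finite_of_finrank_eq_succ hone
  obtain ⟨hfin, hrank⟩ := finrank_quotient_span_pow (K := K) hreg m
  have hspan : Ideal.span {Ideal.Quotient.mk (Ideal.span {x}) g} = Ideal.span {t ^ m} := by
    rw [← Ideal.mem_span_singleton, ← Ideal.Quotient.eq, map_mul, map_pow] at hg
    rw [hg, Ideal.span_singleton_mul_left_unit (hu.map _)]
  rw [hone, mul_one, ← hspan] at hrank
  rw [← hspan] at hfin
  let E := (quotQuotSpanPairEquiv K x g).toLinearEquiv
  exact ⟨Module.Finite.equiv E, by rw [← E.finrank_eq, hrank]⟩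

end PowersOfParameter

section LocalRing

variable {K : Type*} [Field K]

/-- The local ring of the affine plane at `a`. -/
abbrev PointLocalRing (a : Fin 2 → K) : Type _ := Localization.AtPrime (pointIdeal a)

theorem mem_pointIdeal {a : Fin 2 → K} {p : MvPolynomial (Fin 2) K} :
    p ∈ pointIdeal a ↔ eval a p = 0 := RingHom.mem_ker

theorem mem_primeCompl_pointIdeal {a : Fin 2 → K} {p : MvPolynomial (Fin 2) K} :
    p ∈ (pointIdeal a).primeCompl ↔ eval a p ≠ 0 := mem_pointIdeal.not

theorem X_sub_C_mem_pointIdeal (a : Fin 2 → K) (i : Fin 2) : X i - C (a i) ∈ pointIdeal a := by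
  simp [mem_pointIdeal]

theorem pointIdeal_eq_span (a : Fin 2 → K) :
    pointIdeal a = Ideal.span (Set.range fun i => X i - C (a i)) := by
  set I : Ideal (MvPolynomial (Fin 2) K) := Ideal.span (Set.range fun i => X i - C (a i))
  refine le_antisymm (fun p hp => ?_) (Ideal.span_le.2 ?_)
  · have hmk : Ideal.Quotient.mkₐ K I = (Algebra.ofId K _).comp (aeval a) := by
      ext i
      have : X i - C (a i) ∈ I := Ideal.subset_span ⟨i, rfl⟩
      simpa using! Ideal.Quotient.eq.2 this
    rw [← Ideal.Quotient.eq_zero_iff_mem, ← Ideal.Quotient.mkₐ_eq_mk K, hmk, AlgHom.comp_apply,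
      aeval_eq_eval, mem_pointIdeal.1 hp, map_zero]
  · rintro _ ⟨i, rfl⟩
    exact X_sub_C_mem_pointIdeal a i

theorem sub_taylor_mem_pointIdeal_sq (a : Fin 2 → K) (p : MvPolynomial (Fin 2) K) :
    p - C (eval a p) - ∑ i, C (eval a (pderiv i p)) * (X i - C (a i)) ∈ pointIdeal a ^ 2 := by
  induction p using MvPolynomial.induction_on with
  | C c => simp
  | add p q hp hq =>
    have := add_mem hp hq
    simp only [Fin.sum_univ_two, map_add] at this ⊢
    convert this using 1
    ring
  | mul_X p i hp =>
    have hprod : (p - C (eval a p)) * (X i - C (a i)) ∈ pointIdeal a ^ 2 := by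
      rw [pow_two]
      exact Ideal.mul_mem_mul (by simp [mem_pointIdeal]) (X_sub_C_mem_pointIdeal a i)
    have := add_mem hprod (Ideal.mul_mem_right (C (a i)) _ hp)
    simp only [Fin.sum_univ_two, pderiv_mul, map_add, map_mul, eval_X, pderiv_X] at this ⊢
    convert this using 1
    fin_cases i <;> simp <;> ring

/-- The affine linear form through `a` vanishing in the direction `τ`. -/
def tangentForm (a τ : Fin 2 → K) : MvPolynomial (Fin 2) K :=
  C (τ 1) * (X 0 - C (a 0)) - C (τ 0) * (X 1 - C (a 1))

theorem eval_tangentForm (a τ y : Fin 2 → K) :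
    eval y (tangentForm a τ) = τ 1 * (y 0 - a 0) - τ 0 * (y 1 - a 1) := by
  simp [tangentForm]

theorem tangentForm_neg (a τ : Fin 2 → K) : tangentForm a (-τ) = -tangentForm a τ := by
  simp only [tangentForm, Pi.neg_apply, C_neg]
  ring

theorem irreducible_tangentForm (a : Fin 2 → K) {τ : Fin 2 → K} (hτ : τ ≠ 0) :
    Irreducible (tangentForm a τ) := by
  have hne (i : Fin 2) : (0 : Fin 2 →₀ ℕ) ≠ Finsupp.single i 1 :=
    (Finsupp.single_ne_zero.2 one_ne_zero).symm
  have hcoeff0 : coeff (Finsupp.single 0 1) (tangentForm a τ) = τ 1 := by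
    simp [tangentForm, coeff_X, coeff_C, Finsupp.single_left_inj, hne]
  have hcoeff1 : coeff (Finsupp.single 1 1) (tangentForm a τ) = -τ 0 := by
    simp [tangentForm, coeff_X, coeff_C, Finsupp.single_left_inj, hne]
  obtain ⟨i, hi⟩ : ∃ i : Fin 2, coeff (Finsupp.single i 1) (tangentForm a τ) ≠ 0 := by
    by_contra! h
    refine hτ (funext fun i => ?_)
    fin_cases i
    · exact neg_eq_zero.1 (hcoeff1.symm.trans (h 1))
    · exact hcoeff0.symm.trans (h 0)
  have hle (c b : K) (j : Fin 2) : (C c * (X j - C b)).totalDegree ≤ 1 := by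
    refine (totalDegree_mul _ _).trans ?_
    rw [totalDegree_C, zero_add]
    exact (totalDegree_sub _ _).trans (by simp)
  refine irreducible_of_totalDegree_eq_one (le_antisymm ?_ ?_) fun x hx => ?_
  · exact (totalDegree_sub _ _).trans (max_le (hle _ _ _) (hle _ _ _))
  · simpa using le_totalDegree (mem_support_iff.2 hi)
  · exact isUnit_of_dvd_unit (hx _) (IsUnit.mk0 _ hi)

variable {a τ : Fin 2 → K} {F G : MvPolynomial (Fin 2) K}

theorem not_tangentForm_dvd (hτ : eval a (dirDeriv τ F) ≠ 0) : ¬ tangentForm a τ ∣ F := by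
  rintro ⟨q, rfl⟩
  have hderiv : dirDeriv τ (tangentForm a τ) = 0 := by
    simp only [dirDeriv, tangentForm, map_sub, Derivation.leibniz, mkDerivation_X, derivation_C,
      sub_zero, smul_eq_mul]
    ring
  refine hτ ?_
  rw [Derivation.leibniz, hderiv, smul_zero, add_zero, smul_eq_mul, map_mul, eval_tangentForm]
  ring

theorem mul_tangentForm_pow_ne (hF : eval a F = 0) (hτ : eval a (dirDeriv τ F) ≠ 0) (n : ℕ)
    {s : MvPolynomial (Fin 2) K} (hs : eval a s ≠ 0) (b : MvPolynomial (Fin 2) K) :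
    s * tangentForm a τ ^ n ≠ b * F := by
  intro h
  have hτ0 : τ ≠ 0 := by
    rintro rfl
    simp [eval_dirDeriv] at hτ
  have hL := (irreducible_tangentForm a hτ0).prime
  obtain ⟨b, rfl⟩ :=
    hL.pow_dvd_of_dvd_mul_right n (not_tangentForm_dvd hτ) (h ▸ dvd_mul_left _ s)
  rw [mul_comm s, mul_assoc] at h
  rw [mul_left_cancel₀ (pow_ne_zero n hL.ne_zero) h, map_mul, hF, mul_zero] at hs
  exact hs rfl

theorem pointIdeal_le_span_sup_sq (hF : eval a F = 0) (hτ : eval a (dirDeriv τ F) ≠ 0) :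
    pointIdeal a ≤ Ideal.span {F, tangentForm a τ} ⊔ pointIdeal a ^ 2 := by
  set N := Ideal.span {F, tangentForm a τ} ⊔ pointIdeal a ^ 2
  set D := eval a (dirDeriv τ F) with hD
  have hlin : ∑ i, C (eval a (pderiv i F)) * (X i - C (a i)) ∈ N := by
    have hTaylor := sub_taylor_mem_pointIdeal_sq a F
    rw [hF, C_0, sub_zero] at hTaylor
    rw [← sub_sub_cancel F (∑ i, _)]
    exact sub_mem (Ideal.mem_sup_left (Ideal.subset_span (by simp))) (Ideal.mem_sup_right hTaylor)
  have hL : tangentForm a τ ∈ N := Ideal.mem_sup_left (Ideal.subset_span (by simp))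
  rw [Fin.sum_univ_two] at hlin
  rw [pointIdeal_eq_span, Ideal.span_le]
  rintro _ ⟨i, rfl⟩
  suffices h : C D * (X i - C (a i)) ∈ N by
    have := Ideal.mul_mem_left N (C D⁻¹) h
    rwa [← mul_assoc, ← C_mul, inv_mul_cancel₀ hτ, C_1, one_mul] at this
  -- Cramer's rule for the linear system given by the linear part of `F` and the tangent form
  rw [hD, eval_dirDeriv, Fin.sum_univ_two]
  fin_cases i
  · convert add_mem (Ideal.mul_mem_left N (C (τ 0)) hlin)
      (Ideal.mul_mem_left N (C (eval a (pderiv 1 F))) hL) using 1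
    simp only [tangentForm, Fin.zero_eta, C_add, C_mul]
    ring
  · convert sub_mem (Ideal.mul_mem_left N (C (τ 1)) hlin)
      (Ideal.mul_mem_left N (C (eval a (pderiv 0 F))) hL) using 1
    simp only [tangentForm, Fin.mk_one, C_add, C_mul]
    ring

theorem maximalIdeal_eq_span (hF : eval a F = 0) (hτ : eval a (dirDeriv τ F) ≠ 0) :
    IsLocalRing.maximalIdeal (PointLocalRing a) =
      Ideal.span {algebraMap _ _ F, algebraMap _ _ (tangentForm a τ)} := by
  set φ := algebraMap (MvPolynomial (Fin 2) K) (PointLocalRing a)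
  have hspan : (Ideal.span {F, tangentForm a τ}).map φ = Ideal.span {φ F, φ (tangentForm a τ)} := by
    rw [Ideal.map_span, Set.image_pair]
  have hmap : IsLocalRing.maximalIdeal (PointLocalRing a) = (pointIdeal a).map φ :=
    Localization.AtPrime.map_eq_maximalIdeal.symm
  refine le_antisymm ?_ ?_
  · refine Submodule.le_of_le_smul_of_le_jacobson_bot (I := IsLocalRing.maximalIdeal _)
      (IsNoetherian.noetherian _) (IsLocalRing.maximalIdeal_le_jacobson _) ?_
    rw [smul_eq_mul, ← pow_two, hmap, ← Ideal.map_pow, ← hspan, ← Ideal.map_sup]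
    exact Ideal.map_mono (pointIdeal_le_span_sup_sq hF hτ)
  · rw [← hspan, hmap]
    refine Ideal.map_mono (Ideal.span_le.2 ?_)
    rintro p (rfl | rfl)
    · exact mem_pointIdeal.2 hF
    · exact mem_pointIdeal.2 (by simp [eval_tangentForm])

theorem exists_sub_algebraMap_mem_maximalIdeal (y : PointLocalRing a) :
    ∃ c : K, y - algebraMap K _ c ∈ IsLocalRing.maximalIdeal (PointLocalRing a) := by
  obtain ⟨p, s, rfl⟩ := IsLocalization.exists_mk'_eq (pointIdeal a).primeCompl y
  have hs : eval a (s : MvPolynomial (Fin 2) K) ≠ 0 := mem_primeCompl_pointIdeal.1 s.2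
  refine ⟨eval a p / eval a s, ?_⟩
  rw [IsScalarTower.algebraMap_apply K (MvPolynomial (Fin 2) K), algebraMap_eq,
    ← IsLocalization.mk'_one (M := (pointIdeal a).primeCompl), ← IsLocalization.mk'_sub,
    IsLocalization.AtPrime.mk'_mem_maximal_iff _ (pointIdeal a), mem_pointIdeal]
  simp [div_mul_cancel₀ _ hs]

theorem exists_mul_eq_mul_of_algebraMap_dvd {p : MvPolynomial (Fin 2) K}
    (h : algebraMap _ (PointLocalRing a) F ∣ algebraMap _ (PointLocalRing a) p) :
    ∃ s b : MvPolynomial (Fin 2) K, eval a s ≠ 0 ∧ s * p = b * F := by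
  rw [← Ideal.mem_span_singleton, ← Set.image_singleton, ← Ideal.map_span,
    IsLocalization.algebraMap_mem_map_algebraMap_iff (pointIdeal a).primeCompl] at h
  obtain ⟨s, hs, hsp⟩ := h
  obtain ⟨b, hb⟩ := Ideal.mem_span_singleton'.1 hsp
  exact ⟨s, b, mem_primeCompl_pointIdeal.1 hs, hb.symm⟩

theorem exists_mul_eq_mul_tangentForm_pow_add (hF : eval a F = 0)
    (hτ : eval a (dirDeriv τ F) ≠ 0)
    (hG : ∀ s b : MvPolynomial (Fin 2) K, eval a s ≠ 0 → s * G ≠ b * F) :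
    ∃ (m : ℕ) (s w b : MvPolynomial (Fin 2) K), eval a s ≠ 0 ∧ eval a w ≠ 0 ∧
      s * G = w * tangentForm a τ ^ m + b * F := by
  set φ := algebraMap (MvPolynomial (Fin 2) K) (PointLocalRing a)
  obtain ⟨m, u, hu, hdvd⟩ := exists_isUnit_dvd_sub_mul_pow (g := φ G) (maximalIdeal_eq_span hF hτ)
    fun h =>
      let ⟨s, b, hs, hsb⟩ := exists_mul_eq_mul_of_algebraMap_dvd h
      hG s b hs hsb
  obtain ⟨w, s, rfl⟩ := IsLocalization.exists_mk'_eq (pointIdeal a).primeCompl u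
  have hs : eval a (s : MvPolynomial (Fin 2) K) ≠ 0 := mem_primeCompl_pointIdeal.1 s.2
  have hw : eval a w ≠ 0 := mem_primeCompl_pointIdeal.1
    ((IsLocalization.AtPrime.isUnit_mk'_iff (PointLocalRing a) (pointIdeal a) w s).1 hu)
  have hsG : φ F ∣ φ (s * G - w * tangentForm a τ ^ m) := by
    convert hdvd.mul_left (φ s) using 1
    rw [map_sub, map_mul, map_mul, map_pow,
      ← IsLocalization.mk'_spec (PointLocalRing a) w s]
    ring
  obtain ⟨s', b, hs', hsb⟩ := exists_mul_eq_mul_of_algebraMap_dvd hsG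
  refine ⟨m, s' * s, s' * w, b, ?_, ?_, by linear_combination hsb⟩
  · rw [map_mul]
    exact mul_ne_zero hs' hs
  · rw [map_mul]
    exact mul_ne_zero hs' hw

theorem affineIntersectionMultiplicity_eq_of_mul_eq (hF : eval a F = 0)
    (hτ : eval a (dirDeriv τ F) ≠ 0) {m : ℕ} {s w b : MvPolynomial (Fin 2) K} (hs : eval a s ≠ 0)
    (hw : eval a w ≠ 0) (h : s * G = w * tangentForm a τ ^ m + b * F) :
    Module.Finite K (PointLocalRing a ⧸ (Ideal.span {F, G}).map
        (algebraMap (MvPolynomial (Fin 2) K) (PointLocalRing a))) ∧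
      affineIntersectionMultiplicity F G a = m := by
  set φ := algebraMap (MvPolynomial (Fin 2) K) (PointLocalRing a)
  have hunit {p : MvPolynomial (Fin 2) K} (hp : eval a p ≠ 0) : IsUnit (φ p) :=
    IsLocalization.map_units _ (⟨p, mem_primeCompl_pointIdeal.2 hp⟩ : (pointIdeal a).primeCompl)
  obtain ⟨σ, hσ⟩ := hunit hs
  have hdvd : φ F ∣ φ G - ↑σ⁻¹ * φ w * φ (tangentForm a τ) ^ m := by
    refine ⟨↑σ⁻¹ * φ b, ?_⟩
    have h' := congrArg φ h
    rw [map_add, map_mul, map_mul, map_mul, map_pow, ← hσ] at h'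
    linear_combination ↑σ⁻¹ * h' - φ G * σ.inv_mul
  rw [affineIntersectionMultiplicity, Ideal.map_span, Set.image_pair]
  refine finrank_quotient_span_pair (maximalIdeal_eq_span hF hτ)
    exists_sub_algebraMap_mem_maximalIdeal (fun n hn => ?_) (σ⁻¹.isUnit.mul (hunit hw)) hdvd
  rw [← map_pow] at hn
  obtain ⟨s, b, hs, hsb⟩ := exists_mul_eq_mul_of_algebraMap_dvd hn
  exact mul_tangentForm_pow_ne hF hτ n hs b hsb

end LocalRing

section RealAffine

open Filter Topology Asymptotics

theorem eventually_mul_neg_of_hasDerivAt {u : ℝ → ℝ} {c x : ℝ} (hu : HasDerivAt u c x)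
    (hx : u x = 0) (hc : c ≠ 0) : ∀ᶠ t in 𝓝[>] 0, u (x - t) * u (x + t) < 0 := by
  have hsign := eventually_nhdsWithin_sign_eq_of_deriv_pos (f := fun y => c * u y) (x₀ := x)
    (by rw [(hu.const_mul c).deriv]; exact mul_self_pos.2 hc) (by rw [hx, mul_zero])
  have hsub : Tendsto (fun t : ℝ => x - t) (𝓝 0) (𝓝 x) :=
    (by fun_prop : Continuous fun t : ℝ => x - t).tendsto' _ _ (sub_zero x)
  have hadd : Tendsto (fun t : ℝ => x + t) (𝓝 0) (𝓝 x) :=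
    (by fun_prop : Continuous fun t : ℝ => x + t).tendsto' _ _ (add_zero x)
  filter_upwards [nhdsWithin_le_nhds (hsub.eventually hsign),
    nhdsWithin_le_nhds (hadd.eventually hsign), self_mem_nhdsWithin] with t hneg hpos ht
  rw [sub_sub_cancel_left, (sign_neg (neg_lt_zero.2 ht) : SignType.sign (-t) = -1),
    sign_eq_neg_one_iff] at hneg
  rw [add_sub_cancel_left, (sign_pos ht : SignType.sign t = 1), sign_eq_one_iff] at hpos
  refine neg_of_mul_neg_right (a := c ^ 2) ?_ (sq_nonneg c)
  linarith [mul_neg_of_neg_of_pos hneg hpos]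

variable {a τ : Fin 2 → ℝ} {F G H : MvPolynomial (Fin 2) ℝ}

theorem sq_add_sq_pos_of_eval_dirDeriv_ne_zero (hτ : eval a (dirDeriv τ F) ≠ 0) :
    0 < τ 0 ^ 2 + τ 1 ^ 2 := by
  by_contra! hle
  refine hτ ?_
  rw [eval_dirDeriv, Fin.sum_univ_two, pow_eq_zero_iff two_ne_zero |>.1
    (le_antisymm (by nlinarith [sq_nonneg (τ 1)]) (sq_nonneg (τ 0))),
    pow_eq_zero_iff two_ne_zero |>.1
    (le_antisymm (by nlinarith [sq_nonneg (τ 0)]) (sq_nonneg (τ 1)))]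
  ring

theorem frequently_tangentForm_pos (hF : eval a F = 0) (hτ : eval a (dirDeriv τ F) ≠ 0) :
    ∃ᶠ y in 𝓝 a, eval y F = 0 ∧ 0 < eval y (tangentForm a τ) := by
  obtain ⟨ν, hν⟩ : ∃ ν : Fin 2 → ℝ, ν = ![τ 1, -τ 0] := ⟨_, rfl⟩
  set P : ℝ × ℝ → Fin 2 → ℝ := fun z => z.2 • τ + (z.1 • ν + a) with hP
  have hPc : Continuous P := by fun_prop
  have hPa : P 0 = a := by
    simp only [hP, Prod.fst_zero, Prod.snd_zero, zero_smul, zero_add]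
  rw [frequently_iff]
  intro U hU
  have hPU : ∀ᶠ z in 𝓝 0, P z ∈ U := (hPc.tendsto' 0 a hPa).eventually hU
  obtain ⟨r, hr, hball⟩ := Metric.eventually_nhds_iff.1 hPU
  -- a sign change of `F` along `a + ℝ τ`, which persists on the parallels to this line near `a`
  obtain ⟨δ, hδsign, hδ0, hδr⟩ := ((eventually_mul_neg_of_hasDerivAt (x := 0)
    (by simpa using hasDerivAt_eval_line F τ a 0) (by simpa using hF) hτ).and
    (Ioo_mem_nhdsGT hr)).exists
  have hcont (t : ℝ) : Continuous fun s => eval (P (s, t)) F :=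
    (continuous_eval F).comp (hPc.comp (by fun_prop))
  have hsign : ∀ᶠ s in 𝓝[>] 0, eval (P (s, -δ)) F * eval (P (s, δ)) F < 0 :=
    nhdsWithin_le_nhds ((((hcont (-δ)).mul (hcont δ)).tendsto 0).eventually
      (gt_mem_nhds (by simpa only [hP, Pi.mul_apply, zero_smul, zero_sub, zero_add] using hδsign)))
  obtain ⟨s, hs, hs0, hsr⟩ := (hsign.and (Ioo_mem_nhdsGT hr)).exists
  obtain ⟨t, ⟨ht1, ht2⟩, ht⟩ := exists_mem_Ioo_eq_zero_of_mul_neg (u := fun t => eval (P (s, t)) F)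
    (by linarith) ((continuous_eval F).comp (hPc.comp (by fun_prop))).continuousOn hs
  refine ⟨P (s, t), hball ?_, ht, ?_⟩
  · rw [dist_zero_right, Prod.norm_mk, max_lt_iff, Real.norm_eq_abs, Real.norm_eq_abs, abs_lt,
      abs_lt]
    exact ⟨⟨by linarith, hsr⟩, by linarith, by linarith⟩
  · have hval : eval (P (s, t)) (tangentForm a τ) = s * (τ 0 ^ 2 + τ 1 ^ 2) := by
      simp only [eval_tangentForm, hP, hν, Pi.add_apply, Pi.smul_apply, smul_eq_mul,
        Matrix.cons_val_zero, Matrix.cons_val_one]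
      ring
    exact hval ▸ mul_pos hs0 (sq_add_sq_pos_of_eval_dirDeriv_ne_zero hτ)

theorem frequently_tangentForm_neg (hF : eval a F = 0) (hτ : eval a (dirDeriv τ F) ≠ 0) :
    ∃ᶠ y in 𝓝 a, eval y F = 0 ∧ eval y (tangentForm a τ) < 0 := by
  have hτ' : eval a (dirDeriv (-τ) F) ≠ 0 := by
    rw [eval_dirDeriv] at hτ ⊢
    simpa only [Pi.neg_apply, neg_mul, Finset.sum_neg_distrib, neg_ne_zero] using hτ
  simpa only [tangentForm_neg, map_neg, neg_pos] using frequently_tangentForm_pos hF hτ'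

theorem eventually_eq_of_eval_tangentForm_eq_zero (hτ : eval a (dirDeriv τ F) ≠ 0) :
    ∀ᶠ y in 𝓝 a, eval y F = 0 → eval y (tangentForm a τ) = 0 → y = a := by
  have hpos := sq_add_sq_pos_of_eval_dirDeriv_ne_zero hτ
  have hderiv : HasDerivAt (fun t : ℝ => eval (t • τ + a) F) (eval a (dirDeriv τ F)) 0 := by
    simpa using hasDerivAt_eval_line F τ a 0
  have hne := hderiv.eventually_ne (c := 0) hτ
  rw [eventually_nhdsWithin_iff] at hne
  set θ : (Fin 2 → ℝ) → ℝ :=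
    fun y => (τ 0 * (y 0 - a 0) + τ 1 * (y 1 - a 1)) / (τ 0 ^ 2 + τ 1 ^ 2) with hθ
  have hθa : Tendsto θ (𝓝 a) (𝓝 0) :=
    (by fun_prop : Continuous θ).tendsto' a 0 (by simp [hθ])
  filter_upwards [hθa.eventually hne] with y hy hFy hLy
  rw [eval_tangentForm] at hLy
  have hya : y = θ y • τ + a := by
    ext j
    simp only [hθ, Pi.add_apply, Pi.smul_apply, smul_eq_mul]
    rw [div_mul_eq_mul_div, ← sub_eq_iff_eq_add, eq_div_iff hpos.ne']
    fin_cases j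
    · simp only [Fin.zero_eta]
      linear_combination τ 1 * hLy
    · simp only [Fin.mk_one]
      linear_combination -τ 0 * hLy
  have hθy : θ y = 0 := by
    by_contra h
    exact hy h (by rwa [← hya])
  rw [hya, hθy, zero_smul, zero_add]

theorem eventually_mul_eval_pos {s : MvPolynomial (Fin 2) ℝ} (hs : eval a s ≠ 0) :
    ∀ᶠ y in 𝓝 a, 0 < eval a s * eval y s :=
  ((continuous_const.mul (continuous_eval s)).tendsto a).eventually
    (lt_mem_nhds (mul_self_pos.2 hs))

theorem even_of_eventually_nonneg (hF : eval a F = 0) (hτ : eval a (dirDeriv τ F) ≠ 0) {m : ℕ}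
    {s w b : MvPolynomial (Fin 2) ℝ} (hs : eval a s ≠ 0) (hw : eval a w ≠ 0)
    (hG : s * G = w * tangentForm a τ ^ m + b * F) {c : ℝ} (hc : c ≠ 0)
    (hnonneg : ∀ᶠ y in 𝓝 a, eval y F = 0 → 0 ≤ c * eval y G) : Even m := by
  have hsign : ∀ᶠ y in 𝓝 a, eval y F = 0 →
      0 ≤ c * eval a s * eval a w * eval y (tangentForm a τ) ^ m := by
    filter_upwards [hnonneg, eventually_mul_eval_pos hs, eventually_mul_eval_pos hw]
      with y hGy hsy hwy hFy
    have hGy' : eval y s * eval y G = eval y w * eval y (tangentForm a τ) ^ m := by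
      simpa [hFy] using congrArg (eval y) hG
    refine nonneg_of_mul_nonneg_right (a := eval a w * eval y w) ?_ hwy
    calc 0 ≤ eval a s * eval y s * (c * eval y G) * eval a w ^ 2 :=
          mul_nonneg (mul_nonneg hsy.le (hGy hFy)) (sq_nonneg _)
      _ = _ := by linear_combination c * eval a s * eval a w ^ 2 * hGy'
  obtain ⟨y, ⟨hFy, hLy⟩, hy⟩ := ((frequently_tangentForm_pos hF hτ).and_eventually hsign).exists
  obtain ⟨z, ⟨hFz, hLz⟩, hz⟩ := ((frequently_tangentForm_neg hF hτ).and_eventually hsign).exists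
  by_contra hodd
  have hpow := (Nat.not_even_iff_odd.1 hodd).pow_neg hLz
  have hpos := nonneg_of_mul_nonneg_left (hy hFy) (pow_pos hLy m)
  have hzero := le_antisymm (nonpos_of_mul_nonneg_left (hz hFz) hpow) hpos
  exact mul_ne_zero (mul_ne_zero hc hs) hw hzero

theorem eventually_eq_of_eval_eq_zero (hF : eval a F = 0) (hτ : eval a (dirDeriv τ F) ≠ 0)
    (hG : ∀ s b : MvPolynomial (Fin 2) ℝ, eval a s ≠ 0 → s * G ≠ b * F) :
    ∀ᶠ y in 𝓝 a, eval y F = 0 → eval y G = 0 → y = a := by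
  obtain ⟨m, s, w, b, -, hw, h⟩ := exists_mul_eq_mul_tangentForm_pow_add hF hτ hG
  filter_upwards [eventually_mul_eval_pos hw, eventually_eq_of_eval_tangentForm_eq_zero hτ]
    with y hwy hy hFy hGy
  have hpow : eval y w * eval y (tangentForm a τ) ^ m = 0 := by
    simpa [hFy, hGy] using (congrArg (eval y) h).symm
  exact hy hFy (eq_zero_of_pow_eq_zero
    ((mul_eq_zero.1 hpow).resolve_left (right_ne_zero_of_mul hwy.ne')))

theorem even_affineIntersectionMultiplicity (hF : eval a F = 0)
    (hτ : eval a (dirDeriv τ F) ≠ 0)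
    (hG : ∀ s b : MvPolynomial (Fin 2) ℝ, eval a s ≠ 0 → s * G ≠ b * F) {c : ℝ} (hc : c ≠ 0)
    (hnonneg : ∀ᶠ y in 𝓝 a, eval y F = 0 → 0 ≤ c * eval y G) :
    Even (affineIntersectionMultiplicity F G a) := by
  obtain ⟨m, s, w, b, hs, hw, h⟩ := exists_mul_eq_mul_tangentForm_pow_add hF hτ hG
  rw [(affineIntersectionMultiplicity_eq_of_mul_eq hF hτ hs hw h).2]
  exact even_of_eventually_nonneg hF hτ hs hw h hc hnonneg

theorem isBigO_eval_of_mem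
    (hH : algebraMap _ (PointLocalRing a) H ∈ (Ideal.span {F, G}).map
      (algebraMap (MvPolynomial (Fin 2) ℝ) (PointLocalRing a))) :
    (fun y => eval y H) =O[𝓝[{y | eval y F = 0}] a] fun y => eval y G := by
  rw [IsLocalization.algebraMap_mem_map_algebraMap_iff (pointIdeal a).primeCompl] at hH
  obtain ⟨s, hs, hsH⟩ := hH
  obtain ⟨u, v, huv⟩ := Ideal.mem_span_pair.1 hsH
  have hs := mem_primeCompl_pointIdeal.1 hs
  have hbdd : (fun y => eval y v / eval y s) =O[𝓝[{y | eval y F = 0}] a] fun _ => (1 : ℝ) :=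
    (((continuous_eval v).continuousAt.div (continuous_eval s).continuousAt hs).mono_left
      nhdsWithin_le_nhds).isBigO_one ℝ
  refine (hbdd.mul (isBigO_refl (fun y => eval y G) _)).congr' ?_ (by simp)
  filter_upwards [nhdsWithin_le_nhds ((continuous_eval s).continuousAt.eventually_ne hs),
    self_mem_nhdsWithin] with y hsy hFy
  have heval := congrArg (eval y) huv
  rw [map_add, map_mul, map_mul, map_mul, hFy, mul_zero, zero_add] at heval
  rw [div_mul_eq_mul_div, div_eq_iff hsy, heval, mul_comm]

end RealAffine

/-! ### Affine charts -/

section Charts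

variable {K : Type*} [Field K]

/-- The affine coordinates of a point in the `i`-th standard chart; they carry no information
where `x i = 0`. -/
def affinePoint (i : Fin 3) (x : Fin 3 → K) : Fin 2 → K := fun j => x (i.succAbove j) / x i

/-- The point of the plane `x i = 1` with given affine coordinates. -/
def liftPoint (i : Fin 3) (y : Fin 2 → K) : Fin 3 → K := i.insertNth (1 : K) y

@[simp] theorem liftPoint_self (i : Fin 3) (y : Fin 2 → K) : liftPoint i y i = 1 :=
  Fin.insertNth_apply_same ..

@[simp] theorem liftPoint_succAbove (i : Fin 3) (y : Fin 2 → K) (j : Fin 2) :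
    liftPoint i y (i.succAbove j) = y j :=
  Fin.insertNth_apply_succAbove ..

theorem liftPoint_ne_zero (i : Fin 3) (y : Fin 2 → K) : liftPoint i y ≠ 0 := fun h =>
  one_ne_zero ((liftPoint_self i y).symm.trans (congrFun h i))

theorem liftPoint_affinePoint {i : Fin 3} {x : Fin 3 → K} (hx : x i ≠ 0) :
    liftPoint i (affinePoint i x) = (x i)⁻¹ • x := by
  ext k
  rcases Fin.eq_self_or_eq_succAbove i k with rfl | ⟨j, rfl⟩
  · simp [hx]
  · simp [affinePoint, div_eq_inv_mul]

theorem affinePoint_smul (i : Fin 3) {c : K} (hc : c ≠ 0) (x : Fin 3 → K) :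
    affinePoint i (c • x) = affinePoint i x := by
  ext j
  simp [affinePoint, mul_div_mul_left _ _ hc]

theorem mem_span_singleton_of_affinePoint_eq {i : Fin 3} {x y : Fin 3 → K} (hx : x i ≠ 0)
    (hy : y i ≠ 0) (h : affinePoint i y = affinePoint i x) : y ∈ Submodule.span K {x} := by
  have hlift := congrArg (liftPoint i) h
  rw [liftPoint_affinePoint hx, liftPoint_affinePoint hy, inv_smul_eq_iff₀ hy] at hlift
  exact Submodule.mem_span_singleton.2 ⟨y i * (x i)⁻¹, by rw [mul_smul, ← hlift]⟩

/-- `dehomogenize` as a homomorphism of algebras. -/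
def dehomogenizeHom (i : Fin 3) : MvPolynomial (Fin 3) K →ₐ[K] MvPolynomial (Fin 2) K :=
  aeval (i.insertNth (1 : MvPolynomial (Fin 2) K) (X : Fin 2 → MvPolynomial (Fin 2) K) :
    Fin 3 → MvPolynomial (Fin 2) K)

theorem dehomogenizeHom_apply (i : Fin 3) (f : MvPolynomial (Fin 3) K) :
    dehomogenizeHom i f = dehomogenize i f := rfl

@[simp] theorem dehomogenizeHom_X_self (i : Fin 3) : dehomogenizeHom (K := K) i (X i) = 1 := by
  rw [dehomogenizeHom, aeval_X, Fin.insertNth_apply_same]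

@[simp] theorem dehomogenizeHom_X_succAbove (i : Fin 3) (j : Fin 2) :
    dehomogenizeHom (K := K) i (X (i.succAbove j)) = X j := by
  rw [dehomogenizeHom, aeval_X, Fin.insertNth_apply_succAbove]

theorem eval_dehomogenize (i : Fin 3) (f : MvPolynomial (Fin 3) K) (y : Fin 2 → K) :
    eval y (dehomogenize i f) = eval (liftPoint i y) f := by
  rw [← dehomogenizeHom_apply]
  induction f using MvPolynomial.induction_on with
  | C a => simp [algHom_C]
  | add p q hp hq => simp [hp, hq]
  | mul_X p k hp =>
    rcases Fin.eq_self_or_eq_succAbove i k with rfl | ⟨j, rfl⟩ <;> simp [hp]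

theorem eval_dehomogenize_affinePoint {f : MvPolynomial (Fin 3) K} {d : ℕ}
    (hf : f.IsHomogeneous d) {i : Fin 3} {x : Fin 3 → K} (hx : x i ≠ 0) :
    eval (affinePoint i x) (dehomogenize i f) = (x i)⁻¹ ^ d * eval x f := by
  rw [eval_dehomogenize, liftPoint_affinePoint hx, eval_smul_of_isHomogeneous hf]

theorem pderiv_dehomogenize (i : Fin 3) (j : Fin 2) (f : MvPolynomial (Fin 3) K) :
    pderiv j (dehomogenize i f) = dehomogenize i (pderiv (i.succAbove j) f) := by
  simp only [← dehomogenizeHom_apply]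
  induction f using MvPolynomial.induction_on with
  | C a => simp [algHom_C, algebraMap_eq]
  | add p q hp hq => simp [hp, hq]
  | mul_X p k hp =>
    rcases Fin.eq_self_or_eq_succAbove i k with rfl | ⟨l, rfl⟩
    · simp [hp, pderiv_X_of_ne (Fin.succAbove_ne _ _).symm]
    · rcases eq_or_ne l j with rfl | hl
      · simp [hp]
      · simp [hp, pderiv_X_of_ne hl, pderiv_X_of_ne (Fin.succAbove_right_injective.ne hl)]

theorem eq_of_dehomogenize_eq [Infinite K] {f g : MvPolynomial (Fin 3) K} {d : ℕ}
    (hf : f.IsHomogeneous d) (hg : g.IsHomogeneous d) {i : Fin 3}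
    (h : dehomogenize i f = dehomogenize i g) : f = g := by
  refine mul_left_cancel₀ (X_ne_zero (R := K) i) (MvPolynomial.funext fun x => ?_)
  rw [map_mul, map_mul, eval_X]
  rcases eq_or_ne (x i) 0 with hx | hx
  · rw [hx, zero_mul, zero_mul]
  · have heval := congrArg (eval (affinePoint i x)) h
    rw [eval_dehomogenize_affinePoint hf hx, eval_dehomogenize_affinePoint hg hx] at heval
    rw [mul_left_cancel₀ (pow_ne_zero d (inv_ne_zero hx)) heval]

theorem exists_isHomogeneous_dehomogenize_eq (i : Fin 3) (s : MvPolynomial (Fin 2) K) :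
    ∃ (n : ℕ) (S : MvPolynomial (Fin 3) K), S.IsHomogeneous n ∧ dehomogenize i S = s := by
  simp only [← dehomogenizeHom_apply]
  induction s using MvPolynomial.induction_on with
  | C a => exact ⟨0, C a, isHomogeneous_C _ a, algHom_C _ a⟩
  | add p q hp hq =>
    obtain ⟨n, S, hS, rfl⟩ := hp
    obtain ⟨m, T, hT, rfl⟩ := hq
    refine ⟨n + m, S * X i ^ m + T * X i ^ n, ?_, by simp⟩
    exact (hS.mul (isHomogeneous_X_pow i m)).add
      (add_comm m n ▸ hT.mul (isHomogeneous_X_pow i n))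
  | mul_X p j hp =>
    obtain ⟨n, S, hS, rfl⟩ := hp
    exact ⟨n + 1, S * X (i.succAbove j), hS.mul (isHomogeneous_X K _), by simp⟩

/-- Homogenizing `s` and `b` turns an equation `s * g = b * f` in the chart into a relation between
forms, at the cost of a power of the coordinate defining the chart. -/
theorem mul_dehomogenize_ne [Infinite K] {f g : MvPolynomial (Fin 3) K} {d k : ℕ}
    (hf : f.IsHomogeneous d) (hg : g.IsHomogeneous k) (hkd : k < d) (hg0 : g ≠ 0)
    (hirr : Irreducible f) {i : Fin 3} {a : Fin 2 → K} (ha : eval a (dehomogenize i f) = 0)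
    (s b : MvPolynomial (Fin 2) K) (hs : eval a s ≠ 0) :
    s * dehomogenize i g ≠ b * dehomogenize i f := by
  intro h
  obtain ⟨n, S, hS, rfl⟩ := exists_isHomogeneous_dehomogenize_eq i s
  obtain ⟨m, B, hB, rfl⟩ := exists_isHomogeneous_dehomogenize_eq i b
  have hSB : S * X i ^ (m + d) * g = B * X i ^ (n + k) * f := by
    refine eq_of_dehomogenize_eq ((hS.mul (isHomogeneous_X_pow i _)).mul hg) ?_ (i := i) ?_
    · convert (hB.mul (isHomogeneous_X_pow i (n + k))).mul hf using 1
      omega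
    · simp only [← dehomogenizeHom_apply] at h ⊢
      simp [h]
  rcases hirr.prime.dvd_or_dvd (hSB ▸ dvd_mul_left f _) with ⟨q, hq⟩ | hdvd
  · rw [eval_dehomogenize] at ha hs
    have heval := congrArg (eval (liftPoint i a)) hq
    simp [ha, hs] at heval
  · have hdeg := totalDegree_le_of_dvd_of_isDomain hdvd hg0
    rw [hf.totalDegree hirr.ne_zero, hg.totalDegree hg0] at hdeg
    omega

/-- The direction in the `i`-th chart that corresponds, at the point `a`, to the direction `e` in
space. -/
def chartDirection (i : Fin 3) (a : Fin 2 → K) (e : Fin 3 → K) : Fin 2 → K :=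
  fun j => e (i.succAbove j) - a j * e i

theorem eval_dirDeriv_chartDirection {f : MvPolynomial (Fin 3) K} {d : ℕ} (hf : f.IsHomogeneous d)
    (e : Fin 3 → K) {i : Fin 3} {a : Fin 2 → K} (ha : eval a (dehomogenize i f) = 0) :
    eval a (dirDeriv (chartDirection i a e) (dehomogenize i f)) =
      eval (liftPoint i a) (dirDeriv e f) := by
  have heuler := congrArg (eval (liftPoint i a)) hf.sum_X_mul_pderiv
  rw [eval_dehomogenize] at ha
  rw [map_nsmul, ha, smul_zero, map_sum, Fin.sum_univ_succAbove _ i] at heuler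
  simp only [map_mul, eval_X, liftPoint_self, liftPoint_succAbove, one_mul] at heuler
  rw [eval_dirDeriv, eval_dirDeriv, Fin.sum_univ_succAbove _ i]
  simp only [pderiv_dehomogenize, eval_dehomogenize, chartDirection, Fin.sum_univ_two]
    at heuler ⊢
  linear_combination (-e i) * heuler

end Charts

theorem IsRealRegular.exists_eval_dirDeriv_dehomogenize_ne_zero {f : MvPolynomial (Fin 3) ℝ}
    {d : ℕ} (hreg : IsRealRegular f) (hf : f.IsHomogeneous d) {i : Fin 3} {a : Fin 2 → ℝ}
    (ha : eval a (dehomogenize i f) = 0) : ∃ τ, eval a (dirDeriv τ (dehomogenize i f)) ≠ 0 := by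
  obtain ⟨k, hk⟩ := hreg _ (liftPoint_ne_zero i a) (by rwa [← eval_dehomogenize])
  refine ⟨chartDirection i a (Pi.single k 1), ?_⟩
  rw [eval_dirDeriv_chartDirection hf _ ha, eval_dirDeriv]
  simpa [Pi.single_apply] using hk

/-! ### The space of forms of given degree -/

theorem finrank_homogeneousSubmodule (K σ : Type*) [Field K] [Fintype σ] (n : ℕ) :
    Module.finrank K (homogeneousSubmodule σ K n) = (Fintype.card σ + n - 1).choose n := by
  classical
  rw [homogeneousSubmodule_eq_finsupp_supported, ← Finset.card_univ,
    ← Finset.card_finsuppAntidiag_nat_eq_choose]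
  refine (Module.finrank_eq_nat_card_basis (basisRestrictSupport K _)).trans
    (Nat.subtype_card _ fun m => ?_)
  simp [Finset.mem_finsuppAntidiag, Finsupp.degree_eq_sum]

theorem two_mul_finrank_homogeneousSubmodule_fin_three (K : Type*) [Field K] (n : ℕ) :
    2 * Module.finrank K (homogeneousSubmodule (Fin 3) K n) = (n + 2) * (n + 1) := by
  rw [finrank_homogeneousSubmodule, Fintype.card_fin, show 3 + n - 1 = n + 2 by omega,
    Nat.choose_symm_add, Nat.choose_two_right,
    Nat.mul_div_cancel' (Nat.even_mul_pred_self _).two_dvd]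
  rfl

theorem finrank_le_finrank_iInf_ker_add_sum {K ι V : Type*} {W : ι → Type*} [Field K] [Fintype ι]
    [AddCommGroup V] [Module K V] [Module.Finite K V] [∀ i, AddCommGroup (W i)]
    [∀ i, Module K (W i)] [∀ i, Module.Finite K (W i)] (T : ∀ i, V →ₗ[K] W i) :
    Module.finrank K V ≤ Module.finrank K (⨅ i, LinearMap.ker (T i) : Submodule K V) +
      ∑ i, Module.finrank K (W i) := by
  rw [← LinearMap.ker_pi, ← Module.finrank_pi_fintype, add_comm,
    ← (LinearMap.pi T).finrank_range_add_finrank_ker]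
  exact Nat.add_le_add_right (Submodule.finrank_le _) _

/-! ### Compactness arguments on the sphere -/

section Compactness

open Filter Topology Asymptotics

theorem isBigO_principal_of_isCompact {X E F : Type*} [TopologicalSpace X]
    [SeminormedAddCommGroup E] [SeminormedAddCommGroup F] {u : X → E} {v : X → F} {s : Set X}
    (hs : IsCompact s) (h : ∀ x ∈ s, u =O[𝓝[s] x] v) : u =O[𝓟 s] v := by
  refine hs.induction_on (p := fun t => u =O[𝓟 t] v) ?_ (fun _ _ hst ht => ht.mono ?_)
    (fun _ _ hs ht => ?_) fun x hx => ?_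
  · rw [principal_empty]
    exact IsBigO.of_bound 0 eventually_bot
  · exact principal_mono.2 hst
  · rw [← sup_principal]
    exact hs.sup ht
  · obtain ⟨C, hC⟩ := (h x hx).bound
    exact ⟨_, hC, isBigO_principal.2 ⟨C, fun _ hy => hy⟩⟩

variable {E : Type*} [NormedAddCommGroup E] [NormedSpace ℝ E]

theorem finite_setOf_rep_mem [ProperSpace E] {Z : Set E} (hZ : IsClosed Z)
    (hsmul : ∀ c : ℝ, ∀ x ∈ Z, c • x ∈ Z)
    (hline : ∀ x ∈ Z, x ≠ 0 → ∀ᶠ y in 𝓝[Z] x, y ∈ Submodule.span ℝ {x}) :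
    {p : Projectivization ℝ E | p.rep ∈ Z}.Finite := by
  have hcompact : IsCompact (Metric.sphere (0 : E) 1 ∩ Z) := (isCompact_sphere 0 1).inter_right hZ
  have hne {x : E} (hx : x ∈ Metric.sphere (0 : E) 1) : x ≠ 0 :=
    ne_zero_of_mem_unit_sphere ⟨x, hx⟩
  have hfin : ((fun x => Submodule.span ℝ {x}) '' (Metric.sphere (0 : E) 1 ∩ Z)).Finite := by
    refine hcompact.induction_on
      (p := fun s => ((fun x => Submodule.span ℝ {x}) '' s).Finite) (by simp)
      (fun _ _ hst ht => ht.subset (Set.image_mono hst))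
      (fun _ _ hs ht => by rw [Set.image_union]; exact hs.union ht) fun x hx => ?_
    refine ⟨Metric.sphere 0 1 ∩ {y | y ∈ Submodule.span ℝ {x}}, ?_, ?_⟩
    · exact inter_mem (mem_of_superset self_mem_nhdsWithin Set.inter_subset_left)
        (nhdsWithin_mono x Set.inter_subset_right (hline x hx.2 (hne hx.1)))
    · refine (Set.finite_singleton (Submodule.span ℝ {x})).subset ?_
      rintro _ ⟨y, ⟨hy, hyx⟩, rfl⟩
      obtain ⟨c, rfl⟩ := Submodule.mem_span_singleton.1 hyx
      exact Submodule.span_singleton_smul_eq (left_ne_zero_of_smul (hne hy)).isUnit x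
  refine (hfin.preimage Projectivization.submodule_injective.injOn).subset fun p hp => ?_
  have hnorm := norm_ne_zero_iff.2 p.rep_nonzero
  refine ⟨‖p.rep‖⁻¹ • p.rep, ⟨?_, hsmul _ _ hp⟩, ?_⟩
  · rw [mem_sphere_zero_iff_norm, norm_smul, norm_inv, norm_norm, inv_mul_cancel₀ hnorm]
  · exact (Submodule.span_singleton_smul_eq (inv_ne_zero hnorm).isUnit _).trans p.submodule_eq.symm

variable {σ : Type*} [Finite σ] {f g h : MvPolynomial σ ℝ} {d k : ℕ}

theorem exists_abs_eval_le_of_isBigO (hf : f.IsHomogeneous d) (hg : g.IsHomogeneous k)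
    (hh : h.IsHomogeneous k)
    (hloc : ∀ x, x ≠ 0 → eval x f = 0 → eval x g = 0 →
      (fun y => eval y h) =O[𝓝[{y | eval y f = 0}] x] fun y => eval y g) :
    ∃ C : ℝ, ∀ x, x ≠ 0 → eval x f = 0 → |eval x h| ≤ C * |eval x g| := by
  have := Fintype.ofFinite σ
  have hcompact : IsCompact (Metric.sphere (0 : σ → ℝ) 1 ∩ {y | eval y f = 0}) :=
    (isCompact_sphere 0 1).inter_right (isClosed_eq (continuous_eval f) continuous_const)
  obtain ⟨C, hC⟩ := isBigO_principal.1 <| isBigO_principal_of_isCompact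
    (u := fun y => eval y h) (v := fun y => eval y g) hcompact fun x ⟨hx, hfx⟩ => by
      by_cases hgx : eval x g = 0
      · exact (hloc x (ne_zero_of_mem_unit_sphere ⟨x, hx⟩) hfx hgx).mono
          (nhdsWithin_mono x Set.inter_subset_right)
      · refine (isBigO_of_div_tendsto_nhds (l := 𝓝 x) ?_ _ ((continuous_eval h).continuousAt.div
          (continuous_eval g).continuousAt hgx)).mono nhdsWithin_le_nhds
        filter_upwards [(continuous_eval g).continuousAt.eventually_ne hgx] with y hy h0
        exact absurd h0 hy
  refine ⟨C, fun x hx hfx => ?_⟩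
  have hnorm : 0 < ‖x‖⁻¹ := inv_pos.2 (norm_pos_iff.2 hx)
  have hle := hC (‖x‖⁻¹ • x) ⟨mem_sphere_zero_iff_norm.2 (norm_smul_inv_norm hx), by
    rw [Set.mem_ofPred, eval_smul_of_isHomogeneous hf, hfx, mul_zero]⟩
  rw [eval_smul_of_isHomogeneous hg, eval_smul_of_isHomogeneous hh, norm_mul, norm_mul,
    mul_left_comm] at hle
  exact le_of_mul_le_mul_left hle (norm_pos_iff.2 (pow_pos hnorm k).ne')

end Compactness

/-! ### Intersections of a real curve with a form of smaller degree -/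

section IntersectionAlgebra

variable {K : Type*} [Field K]

/-- The affine coordinates of a point of the projective plane in the chart `chartIndex p`. -/
def chartPoint (p : Projectivization K (Fin 3 → K)) : Fin 2 → K :=
  affinePoint (chartIndex p) p.rep

/-- The local algebra `𝒪_p / (f, g)` of the intersection of two plane curves at `p`, whose
dimension is `intersectionMultiplicity f g p`. -/
abbrev IntersectionAlgebra (f g : MvPolynomial (Fin 3) K) (p : Projectivization K (Fin 3 → K)) :
    Type _ :=
  PointLocalRing (chartPoint p) ⧸
    (Ideal.span {dehomogenize (chartIndex p) f, dehomogenize (chartIndex p) g}).map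
      (algebraMap (MvPolynomial (Fin 2) K) (PointLocalRing (chartPoint p)))

theorem finrank_intersectionAlgebra (f g : MvPolynomial (Fin 3) K)
    (p : Projectivization K (Fin 3 → K)) :
    Module.finrank K (IntersectionAlgebra f g p) = intersectionMultiplicity f g p := rfl

/-- The germ at `p` of a form, read in the chart `chartIndex p` and reduced modulo `f` and `g`. -/
def toIntersectionAlgebra (f g : MvPolynomial (Fin 3) K) (p : Projectivization K (Fin 3 → K)) :
    MvPolynomial (Fin 3) K →ₐ[K] IntersectionAlgebra f g p :=
  ((Ideal.Quotient.mkₐ K _).comp (IsScalarTower.toAlgHom K (MvPolynomial (Fin 2) K) _)).comp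
    (dehomogenizeHom (chartIndex p))

theorem toIntersectionAlgebra_eq_zero_iff {f g h : MvPolynomial (Fin 3) K}
    {p : Projectivization K (Fin 3 → K)} :
    toIntersectionAlgebra f g p h = 0 ↔
      algebraMap _ (PointLocalRing (chartPoint p)) (dehomogenize (chartIndex p) h) ∈
        (Ideal.span {dehomogenize (chartIndex p) f, dehomogenize (chartIndex p) g}).map
          (algebraMap (MvPolynomial (Fin 2) K) (PointLocalRing (chartPoint p))) :=
  Ideal.Quotient.eq_zero_iff_mem

theorem rep_chartIndex_ne_zero (p : Projectivization K (Fin 3 → K)) : p.rep (chartIndex p) ≠ 0 :=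
  (exists_rep_apply_ne_zero p).choose_spec

theorem eval_chartPoint_dehomogenize {f : MvPolynomial (Fin 3) K} {d : ℕ} (hf : f.IsHomogeneous d)
    {p : Projectivization K (Fin 3 → K)} (hp : eval p.rep f = 0) :
    eval (chartPoint p) (dehomogenize (chartIndex p) f) = 0 := by
  rw [chartPoint, eval_dehomogenize_affinePoint hf (rep_chartIndex_ne_zero p), hp, mul_zero]

theorem apply_chartIndex_mk_ne_zero {x : Fin 3 → K} (hx : x ≠ 0) :
    x (chartIndex (Projectivization.mk K x hx)) ≠ 0 := by
  obtain ⟨c, hc⟩ := Projectivization.exists_smul_eq_mk_rep K x hx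
  have hrep := rep_chartIndex_ne_zero (Projectivization.mk K x hx)
  rw [← hc] at hrep
  exact right_ne_zero_of_smul (a := (c : K)) hrep

theorem chartPoint_mk {x : Fin 3 → K} (hx : x ≠ 0) : chartPoint (Projectivization.mk K x hx) =
    affinePoint (chartIndex (Projectivization.mk K x hx)) x := by
  obtain ⟨c, hc⟩ := Projectivization.exists_smul_eq_mk_rep K x hx
  rw [chartPoint, ← hc]
  exact affinePoint_smul _ c.ne_zero x

theorem eval_rep_mk_eq_zero {f : MvPolynomial (Fin 3) K} {d : ℕ} (hf : f.IsHomogeneous d)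
    {x : Fin 3 → K} (hx : x ≠ 0) (hfx : eval x f = 0) :
    eval (Projectivization.mk K x hx).rep f = 0 := by
  obtain ⟨c, hc⟩ := Projectivization.exists_smul_eq_mk_rep K x hx
  rw [← hc]
  exact (eval_smul_of_isHomogeneous hf (c : K) x).trans (by rw [hfx, mul_zero])

end IntersectionAlgebra

section RealPlane

open Filter Topology Asymptotics

variable {f g h : MvPolynomial (Fin 3) ℝ} {d k : ℕ}

theorem tendsto_affinePoint_nhdsWithin (hf : f.IsHomogeneous d) {i : Fin 3} {x : Fin 3 → ℝ}
    (hx : x i ≠ 0) : Tendsto (affinePoint i) (𝓝[{y | eval y f = 0}] x)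
      (𝓝[{y | eval y (dehomogenize i f) = 0}] affinePoint i x) := by
  refine tendsto_nhdsWithin_iff.2 ⟨tendsto_nhdsWithin_of_tendsto_nhds (tendsto_pi_nhds.2 fun j =>
    ((continuous_apply (i.succAbove j)).tendsto x).div ((continuous_apply i).tendsto x) hx), ?_⟩
  filter_upwards [nhdsWithin_le_nhds ((continuous_apply i).continuousAt.eventually_ne hx),
    self_mem_nhdsWithin] with y hyi hfy
  rw [eval_dehomogenize_affinePoint hf hyi, hfy, mul_zero]

theorem isBigO_of_isBigO_dehomogenize (hf : f.IsHomogeneous d) (hg : g.IsHomogeneous k)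
    (hh : h.IsHomogeneous k) {i : Fin 3} {x : Fin 3 → ℝ} (hx : x i ≠ 0)
    (hO : (fun y => eval y (dehomogenize i h))
      =O[𝓝[{y | eval y (dehomogenize i f) = 0}] affinePoint i x]
        fun y => eval y (dehomogenize i g)) :
    (fun y => eval y h) =O[𝓝[{y | eval y f = 0}] x] fun y => eval y g := by
  obtain ⟨C, hC⟩ := (hO.comp_tendsto (tendsto_affinePoint_nhdsWithin hf hx)).bound
  refine IsBigO.of_bound C ?_
  filter_upwards [hC, nhdsWithin_le_nhds ((continuous_apply i).continuousAt.eventually_ne hx)]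
    with y hy hyi
  rw [Function.comp_apply, Function.comp_apply, eval_dehomogenize_affinePoint hh hyi,
    eval_dehomogenize_affinePoint hg hyi, norm_mul, norm_mul, mul_left_comm] at hy
  exact le_of_mul_le_mul_left hy (norm_pos_iff.2 (pow_ne_zero k (inv_ne_zero hyi)))

theorem exists_abs_eval_le_of_toIntersectionAlgebra_eq_zero (hf : f.IsHomogeneous d)
    (hg : g.IsHomogeneous k) (hh : h.IsHomogeneous k)
    (hzero : ∀ p : Projectivization ℝ (Fin 3 → ℝ), eval p.rep f = 0 → eval p.rep g = 0 →
      toIntersectionAlgebra f g p h = 0) :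
    ∃ C : ℝ, ∀ x, x ≠ 0 → eval x f = 0 → |eval x h| ≤ C * |eval x g| := by
  refine exists_abs_eval_le_of_isBigO hf hg hh fun x hx hfx hgx => ?_
  have hO := isBigO_eval_of_mem (toIntersectionAlgebra_eq_zero_iff.1 (hzero
    (Projectivization.mk ℝ x hx) (eval_rep_mk_eq_zero hf hx hfx) (eval_rep_mk_eq_zero hg hx hgx)))
  rw [chartPoint_mk hx] at hO
  exact isBigO_of_isBigO_dehomogenize hf hg hh (apply_chartIndex_mk_ne_zero hx) hO

theorem eventually_mem_span_of_eval_eq_zero (hf : f.IsHomogeneous d) (hirr : Irreducible f)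
    (hreg : IsRealRegular f) (hg : g.IsHomogeneous k) (hkd : k < d) (hg0 : g ≠ 0)
    {x : Fin 3 → ℝ} (hx : x ≠ 0) (hfx : eval x f = 0) :
    ∀ᶠ y in 𝓝[{y | eval y f = 0 ∧ eval y g = 0}] x, y ∈ Submodule.span ℝ {x} := by
  obtain ⟨i, hi⟩ := Function.ne_iff.1 hx
  have ha : eval (affinePoint i x) (dehomogenize i f) = 0 := by
    rw [eval_dehomogenize_affinePoint hf hi, hfx, mul_zero]
  obtain ⟨τ, hτ⟩ := hreg.exists_eval_dirDeriv_dehomogenize_ne_zero hf ha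
  have hlocal := eventually_eq_of_eval_eq_zero ha hτ (mul_dehomogenize_ne hf hg hkd hg0 hirr ha)
  have htendsto := (tendsto_affinePoint_nhdsWithin hf hi).mono_right nhdsWithin_le_nhds
  filter_upwards [nhdsWithin_mono x (fun y hy => hy.1) (htendsto.eventually hlocal),
    nhdsWithin_le_nhds ((continuous_apply i).continuousAt.eventually_ne hi), self_mem_nhdsWithin]
    with y hy hyi ⟨hfy, hgy⟩
  refine mem_span_singleton_of_affinePoint_eq hi hyi (hy ?_ ?_)
  · rw [eval_dehomogenize_affinePoint hf hyi, hfy, mul_zero]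
  · rw [eval_dehomogenize_affinePoint hg hyi, hgy, mul_zero]

theorem finite_setOf_eval_rep_eq_zero (hf : f.IsHomogeneous d) (hirr : Irreducible f)
    (hreg : IsRealRegular f) (hg : g.IsHomogeneous k) (hkd : k < d) (hg0 : g ≠ 0) :
    {p : Projectivization ℝ (Fin 3 → ℝ) | eval p.rep f = 0 ∧ eval p.rep g = 0}.Finite := by
  refine finite_setOf_rep_mem (Z := {x : Fin 3 → ℝ | eval x f = 0 ∧ eval x g = 0})
    ((isClosed_eq (continuous_eval f) continuous_const).inter
      (isClosed_eq (continuous_eval g) continuous_const)) (fun c x hx => ?_) fun x hx hx0 =>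
    eventually_mem_span_of_eval_eq_zero hf hirr hreg hg hkd hg0 hx0 hx.1
  rw [Set.mem_ofPred, eval_smul_of_isHomogeneous hf, eval_smul_of_isHomogeneous hg, hx.1, hx.2,
    mul_zero, mul_zero]
  exact ⟨rfl, rfl⟩

theorem finite_intersectionAlgebra (hf : f.IsHomogeneous d) (hirr : Irreducible f)
    (hreg : IsRealRegular f) (hg : g.IsHomogeneous k) (hkd : k < d) (hg0 : g ≠ 0)
    {p : Projectivization ℝ (Fin 3 → ℝ)} (hp : eval p.rep f = 0) :
    Module.Finite ℝ (IntersectionAlgebra f g p) := by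
  have ha := eval_chartPoint_dehomogenize hf hp
  obtain ⟨τ, hτ⟩ := hreg.exists_eval_dirDeriv_dehomogenize_ne_zero hf ha
  obtain ⟨m, s, w, b, hs, hw, hsw⟩ :=
    exists_mul_eq_mul_tangentForm_pow_add ha hτ (mul_dehomogenize_ne hf hg hkd hg0 hirr ha)
  exact (affineIntersectionMultiplicity_eq_of_mul_eq ha hτ hs hw hsw).1

theorem sum_intersectionMultiplicity_realContactPoints [Fintype (realContactPoints f g)] :
    ∑ p : realContactPoints f g, intersectionMultiplicity f g p = 2 * realContactCount f g := by
  rw [realContactCount, finsum_mem_eq_toFinset_sum, Finset.mul_sum,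
    ← Finset.sum_subtype _ (fun _ => Set.mem_toFinset) fun p => intersectionMultiplicity f g p]
  exact Finset.sum_congr rfl fun p hp =>
    (Nat.two_mul_div_two_of_even (Set.mem_toFinset.1 hp).2.2).symm

end RealPlane

/-! ### Interlacers -/

section Interlacer

open Filter Topology

variable {d : ℕ} {f g h : MvPolynomial (Fin 3) ℝ} {e : Fin 3 → ℝ}

theorem one_le_of_irreducible_of_isHomogeneous {σ K : Type*} [Field K] {p : MvPolynomial σ K}
    {n : ℕ} (hp : Irreducible p) (hn : p.IsHomogeneous n) : 1 ≤ n := by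
  rw [Nat.one_le_iff_ne_zero]
  rintro rfl
  exact hp.not_isUnit (isUnit_of_isHomogeneous_zero hp.ne_zero hn)

theorem ne_zero_of_mem_interlacerCone (hg : g ∈ interlacerCone d f e) : g ≠ 0 := by
  rintro rfl
  exact hg.2.2.ne' (map_zero _)

theorem even_intersectionMultiplicity_of_mem_interlacerCone (hf : f.IsHomogeneous d)
    (hirr : Irreducible f) (hreg : IsRealRegular f) (hyp : IsHyperbolic f e)
    (hg : g ∈ interlacerCone d f e) {p : Projectivization ℝ (Fin 3 → ℝ)} (hp : eval p.rep f = 0) :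
    Even (intersectionMultiplicity f g p) := by
  have hd := one_le_of_irreducible_of_isHomogeneous hirr hf
  have ha := eval_chartPoint_dehomogenize hf hp
  obtain ⟨τ, hτ⟩ := hreg.exists_eval_dirDeriv_dehomogenize_ne_zero hf ha
  have hD : eval (chartPoint p) (dehomogenize (chartIndex p) (dirDeriv e f)) ≠ 0 := by
    rw [eval_dehomogenize] at ha ⊢
    exact hreg.eval_dirDeriv_ne_zero hf hyp (liftPoint_ne_zero _ _) ha
  have hDpos := eventually_mul_eval_pos hD
  refine even_affineIntersectionMultiplicity ha hτ
    (mul_dehomogenize_ne hf hg.1 (by omega) (ne_zero_of_mem_interlacerCone hg) hirr ha)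
    (mul_ne_zero hyp.1 hD) ?_
  filter_upwards [hDpos] with y hDy hfy
  have hsign := mul_eval_nonneg_of_mem_interlacerCone hf hyp hg
    ((eval_dehomogenize _ _ _).symm.trans hfy)
  rw [← eval_dehomogenize, ← eval_dehomogenize] at hsign
  refine nonneg_of_mul_nonneg_left (b := eval y (dehomogenize (chartIndex p) (dirDeriv e f)) ^ 2)
    ?_ (sq_pos_of_ne_zero (right_ne_zero_of_mul hDy.ne'))
  linarith [mul_nonneg hsign hDy.le]

theorem realContactPoints_eq_of_mem_interlacerCone (hf : f.IsHomogeneous d)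
    (hirr : Irreducible f) (hreg : IsRealRegular f) (hyp : IsHyperbolic f e)
    (hg : g ∈ interlacerCone d f e) :
    realContactPoints f g = {p | eval p.rep f = 0 ∧ eval p.rep g = 0} :=
  Set.ext fun _ => ⟨fun hp => ⟨hp.1, hp.2.1⟩, fun hp => ⟨hp.1, hp.2,
    even_intersectionMultiplicity_of_mem_interlacerCone hf hirr hreg hyp hg hp.1⟩⟩

theorem add_smul_mem_interlacerCone (hd : 1 ≤ d) (hf : f.IsHomogeneous d) (hreg : IsRealRegular f)
    (hyp : IsHyperbolic f e) (hg : g ∈ interlacerCone d f e) (hh : h.IsHomogeneous (d - 1)) {ε : ℝ}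
    (hε : ∀ x, x ≠ 0 → eval x f = 0 → |ε| * |eval x h| ≤ |eval x g|)
    (hεe : |ε| * |eval e h| < eval e g) : g + ε • h ∈ interlacerCone d f e := by
  refine mem_interlacerCone_of_mul_eval_nonneg hd hf hyp
    (fun p => hreg.eval_dirDeriv_ne_zero hf hyp) ?_ ?_ fun p hp0 hp => ?_
  · rw [smul_eq_C_mul]
    exact hg.1.add (hh.C_mul ε)
  · rw [map_add, smul_eval]
    rw [← abs_mul] at hεe
    linarith [neg_abs_le (ε * eval e h)]
  · have hsign := mul_eval_nonneg_of_mem_interlacerCone hf hyp hg hp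
    rw [map_add, smul_eval, mul_add]
    set c := eval e f * eval p (dirDeriv e f)
    have hle : |c * (ε * eval p h)| ≤ c * eval p g := by
      rw [← abs_of_nonneg hsign, abs_mul, abs_mul c, abs_mul ε]
      exact mul_le_mul_of_nonneg_left (hε p hp0 hp) (abs_nonneg c)
    linarith [neg_abs_le (c * (ε * eval p h))]

theorem IsExtremalInterlacer.eq_smul_of_add_mem_of_sub_mem (hg : IsExtremalInterlacer d f e g)
    (hadd : g + h ∈ interlacerCone d f e) (hsub : g - h ∈ interlacerCone d f e) :
    ∃ c : ℝ, h = c • g := by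
  obtain ⟨c, -, hc⟩ := hg.2.left_mem_of_mem_openSegment hadd hsub
    ⟨1, one_pos, (one_smul ℝ g).symm⟩
    ⟨1 / 2, 1 / 2, by norm_num, by norm_num, by norm_num, by module⟩
  exact ⟨c - 1, by rw [sub_smul, one_smul, ← hc, add_sub_cancel_left]⟩

theorem IsExtremalInterlacer.eq_smul_of_abs_eval_le (hd : 1 ≤ d) (hf : f.IsHomogeneous d)
    (hreg : IsRealRegular f) (hyp : IsHyperbolic f e) (hg : IsExtremalInterlacer d f e g)
    (hh : h.IsHomogeneous (d - 1)) {C : ℝ}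
    (hC : ∀ x, x ≠ 0 → eval x f = 0 → |eval x h| ≤ C * |eval x g|) : ∃ c : ℝ, h = c • g := by
  obtain ⟨ε, hε, hεlt⟩ := exists_pos_mul_lt (lt_min one_pos hg.1.2.2) (max C |eval e h|)
  have hεC : C * ε ≤ 1 := ((mul_le_mul_of_nonneg_right (le_max_left _ _) hε.le).trans_lt
    (hεlt.trans_le (min_le_left _ _))).le
  have hεe : ε * |eval e h| < eval e g := mul_comm |eval e h| ε ▸
    (mul_le_mul_of_nonneg_right (le_max_right _ _) hε.le).trans_lt
      (hεlt.trans_le (min_le_right _ _))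
  have hdom (x : Fin 3 → ℝ) (hx : x ≠ 0) (hfx : eval x f = 0) :
      ε * |eval x h| ≤ |eval x g| :=
    calc ε * |eval x h| ≤ ε * (C * |eval x g|) := mul_le_mul_of_nonneg_left (hC x hx hfx) hε.le
      _ = C * ε * |eval x g| := by ring
      _ ≤ |eval x g| := mul_le_of_le_one_left (abs_nonneg _) hεC
  have hmem {δ : ℝ} (hδ : |δ| = ε) : g + δ • h ∈ interlacerCone d f e :=
    add_smul_mem_interlacerCone hd hf hreg hyp hg.1 hh (by rwa [hδ]) (by rwa [hδ])
  obtain ⟨c, hc⟩ := hg.eq_smul_of_add_mem_of_sub_mem (hmem (abs_of_pos hε))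
    (by simpa only [neg_smul, ← sub_eq_add_neg] using
      hmem ((abs_neg ε).trans (abs_of_pos hε)))
  exact ⟨ε⁻¹ * c, by rw [mul_smul, ← hc, inv_smul_smul₀ hε.ne']⟩

theorem IsExtremalInterlacer.finrank_iInf_ker_toIntersectionAlgebra_le_one
    (hf : f.IsHomogeneous d) (hirr : Irreducible f) (hreg : IsRealRegular f)
    (hyp : IsHyperbolic f e) (hg : IsExtremalInterlacer d f e g) :
    Module.finrank ℝ (⨅ p : realContactPoints f g, LinearMap.ker
      ((toIntersectionAlgebra f g p).toLinearMap.domRestrict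
        (homogeneousSubmodule (Fin 3) ℝ (d - 1))) : Submodule ℝ _) ≤ 1 := by
  have hd := one_le_of_irreducible_of_isHomogeneous hirr hf
  have hspan : (⨅ p : realContactPoints f g, LinearMap.ker
      ((toIntersectionAlgebra f g p).toLinearMap.domRestrict
        (homogeneousSubmodule (Fin 3) ℝ (d - 1)))) ≤ Submodule.span ℝ {⟨g, hg.1.1⟩} := by
    intro h hh
    rw [Submodule.mem_iInf] at hh
    obtain ⟨C, hC⟩ := exists_abs_eval_le_of_toIntersectionAlgebra_eq_zero hf hg.1.1 h.2
      fun p hpf hpg => hh ⟨p, by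
        rw [realContactPoints_eq_of_mem_interlacerCone hf hirr hreg hyp hg.1]
        exact ⟨hpf, hpg⟩⟩
    obtain ⟨c, hc⟩ := hg.eq_smul_of_abs_eval_le hd hf hreg hyp h.2 hC
    exact Submodule.mem_span_singleton.2 ⟨c, Subtype.ext hc.symm⟩
  exact (Submodule.finrank_mono hspan).trans ((finrank_span_le_card _).trans (by simp))

end Interlacer

theorem ceil_le_of_mul_le_four_mul_add_two {d m : ℕ} (h : (d + 1) * d ≤ 4 * m + 2) :
    ⌈(((d : ℝ) + 1) * d - 2) / 4⌉₊ ≤ m := by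
  have hcast : ((d : ℝ) + 1) * d ≤ 4 * m + 2 := by exact_mod_cast h
  rw [Nat.ceil_le, div_le_iff₀ four_pos]
  linarith

theorem lemma1p3_general {d : ℕ} {f g : MvPolynomial (Fin 3) ℝ} {e : Fin 3 → ℝ}
    (hf : f.IsHomogeneous d) (hirr : Irreducible f) (hreg : IsRealRegular f)
    (hyp : IsHyperbolic f e) (hg : IsExtremalInterlacer d f e g) :
    (realContactPoints f g).Finite ∧
      ⌈(((d : ℝ) + 1) * d - 2) / 4⌉₊ ≤ realContactCount f g := by
  have hd := one_le_of_irreducible_of_isHomogeneous hirr hf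
  have hlt : d - 1 < d := by omega
  have hg0 := ne_zero_of_mem_interlacerCone hg.1
  have hfin : (realContactPoints f g).Finite := by
    rw [realContactPoints_eq_of_mem_interlacerCone hf hirr hreg hyp hg.1]
    exact finite_setOf_eval_rep_eq_zero hf hirr hreg hg.1.1 hlt hg0
  refine ⟨hfin, ceil_le_of_mul_le_four_mul_add_two ?_⟩
  have := hfin.fintype
  have (p : realContactPoints f g) : Module.Finite ℝ (IntersectionAlgebra f g p) :=
    finite_intersectionAlgebra hf hirr hreg hg.1.1 hlt hg0 p.2.1
  have : Module.Finite ℝ (homogeneousSubmodule (Fin 3) ℝ (d - 1)) :=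
    Module.Finite.iff_fg.2 (homogeneousSubmodule_fg _ _ _)
  have hrank := finrank_le_finrank_iInf_ker_add_sum (K := ℝ)
    (W := fun p : realContactPoints f g => IntersectionAlgebra f g p.1) fun p =>
    (toIntersectionAlgebra f g p).toLinearMap.domRestrict (homogeneousSubmodule (Fin 3) ℝ (d - 1))
  simp only [finrank_intersectionAlgebra, sum_intersectionMultiplicity_realContactPoints] at hrank
  have hker := hg.finrank_iInf_ker_toIntersectionAlgebra_le_one hf hirr hreg hyp
  have hdim := two_mul_finrank_homogeneousSubmodule_fin_three ℝ (d - 1)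
  obtain ⟨n, rfl⟩ := Nat.exists_eq_add_of_le' hd
  rw [Nat.add_sub_cancel] at *
  linarith

end

theorem lemma1p3 (d : ℕ) (hd : 1 ≤ d) (f : MvPolynomial (Fin 3) ℝ) (hf : f.IsHomogeneous d)
    (e : Fin 3 → ℝ) (hyp : IsHyperbolic f e) (hsmooth : IsSmoothCurve f)
    (g : MvPolynomial (Fin 3) ℝ) (hg : IsExtremalInterlacer d f e g) :
    (realContactPoints f g).Finite ∧
      ⌈(((d : ℝ) + 1) * d - 2) / 4⌉₊ ≤ realContactCount f g := by
  have hf0 : f ≠ 0 := fun h => hyp.1 (h ▸ map_zero _)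
  exact lemma1p3_general hf (hsmooth.irreducible hd hf hf0) hsmooth.isRealRegular hyp hg
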